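/- Let $G=(V,E)$ be a finite planar graph with root $r\in V$, costs $w\colon V\to\mathbb R_{\ge 0}$ and penalties $\pi\colon V\to\mathbb R_{\ge 0}$, such that $w_r=0$ and every vertex $v$ has $w_v=0$ or $\pi_v=0$. A *terminal* is a vertex with $\pi_v>0$. Write $w(X)=\sum_{v\in X}w_v$, $\Pi(X)=\sum_{v\in X}\pi_v$, and let $\Gamma(S)$ be the set of vertices outside $S$ with a neighbor in $S$. A *solution* of the node-weighted prize-collecting Steiner tree problem is a set $F\ni r$ with $G[F]$ connected; its value is $w(F)+\Pi(V\setminus F)$, and $OPT$ is the minimum value. A vector $(y_S)_{S\subseteq V\setminus\{r\}}$ is *dual feasible* if $y\ge 0$, $\sum_{S:v\in\Gamma(S)}y_S\le w_v$ for all $v\in V$, and $\sum_{S\subseteq X}y_S\le\Pi(X)$ for all $X\subseteq V\setminus\{r\}$. Consider the following algorithm. *Growth phase.* Initially the set $F$ of bought vertices consists of $r$ and all terminals, $y=0$, and no terminal is marked. The moats are the connected components of $G[F]$; the moat containing $r$ is always inactive, all other initial moats are active. While there is an active moat, iteration $t=1,2,\dots$ increases the variables $y_S$ of all active moats $S$ uniformly,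 keeping $y$ dual feasible, until (a) $\sum_{S:v\in\Gamma(S)}y_S=w_v$ for some vertex $v\notin F$, or (b) $\sum_{S\subseteq X}y_S=\Pi(X)$ for some active moat $X$; one such event is processed, with ties broken arbitrarily. (A vertex $v \notin F$ that is tight but not adjacent to an active moat may be bought, without growth, or left.) In case (a), $v$ is bought at time $t$, which merges $v$ and the moats adjacent to it into a new moat; it is inactive if it contains $r$ and active otherwise. In case (b), $X$ becomes inactive and all unmarked terminals in $X$ are marked with time $t$. *Pruning phase.* Start with the connected component of $G[F]$ containing $r$ and consider its vertices in the reverse order of purchase. A vertex $v$ that is still present and was bought at time $t$ is deleted, together with all vertices that become disconnected from $r$, if this does not disconnect from $r$ any still present terminal that was unmarked at time $t$ (a deleted terminal counts as disconnected). The remaining set $F'$ is the output. Then the growth phase never gets stuck and always terminates. For every run of the algorithm, the final $y$ is dual feasible, the output $F'$ contains $r$ and induces a connected subgraph, and $$w(F')+3\,\Pi(V\setminus F')\;\le\;3\sum_{S\subseteq V\setminus\{r\}}y_S\;\le\;3\,OPT .$$ That is, the algorithm is a Lagrangian-multiplier-preserving 3-approximation. -/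

import Mathlib

/-! ### Planar graphs

A finite simple graph is planar if it has a planar combinatorial embedding: a rotation system
(a cyclic order of the edges around each vertex) whose faces satisfy Euler's equation, i.e. which
embeds every connected component in the sphere. -/

/-- Reversal of darts (oriented edges) as a permutation. -/
def dartReverse {V : Type*} (G : SimpleGraph V) : Equiv.Perm G.Dart where
  toFun := SimpleGraph.Dart.symm
  invFun := SimpleGraph.Dart.symm
  left_inv := SimpleGraph.Dart.symm_symm
  right_inv := SimpleGraph.Dart.symm_symm

/-- A rotation system: a permutation of the darts whose cycles are exactly the sets of darts
leaving a common vertex; `σ d` is the dart following `d` in the cyclic order around its tail. -/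
def IsRotationSystem {V : Type*} (G : SimpleGraph V) (σ : Equiv.Perm G.Dart) : Prop :=
  ∀ d e : G.Dart, σ.SameCycle d e ↔ d.fst = e.fst

/-- The number of faces of a rotation system. A face is a cycle of `d ↦ σ (reverse of d)`; an
isolated vertex has no darts, and drawn on its own sphere it has exactly one face. -/
noncomputable def numFaces {V : Type*} (G : SimpleGraph V) (σ : Equiv.Perm G.Dart) : ℕ :=
  Nat.card (Quotient (Equiv.Perm.SameCycle.setoid (σ * dartReverse G)))
    + Nat.card {v : V // ∀ u, ¬ G.Adj v u}

/-- A finite graph is planar if it has a rotation system of genus zero: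
`|V| - |E| + |faces| = 2 * (number of connected components)`, where the faces are counted
separately for each component. -/
def IsPlanar {V : Type*} [Finite V] (G : SimpleGraph V) : Prop :=
  ∃ σ : Equiv.Perm G.Dart, IsRotationSystem G σ ∧
    Nat.card V + numFaces G σ = Nat.card G.edgeSet + 2 * Nat.card G.ConnectedComponent

/-! ### The problem and its dual linear program -/

/-- An instance of node-weighted prize-collecting Steiner tree, normalised as usual: the root is
free, and each vertex has zero cost or zero penalty. -/
structure NWPCST (V : Type*) where
  /-- the graph -/
  G : SimpleGraph V
  /-- the root -/
  r : V
  /-- the costs -/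
  w : V → ℝ
  /-- the penalties -/
  π : V → ℝ
  w_nonneg : ∀ v, 0 ≤ w v
  π_nonneg : ∀ v, 0 ≤ π v
  w_root : w r = 0
  w_or_π : ∀ v, w v = 0 ∨ π v = 0

namespace NWPCST

open Finset

/-- `w(X)`, the total cost of a vertex set. -/
def weight {V : Type*} (I : NWPCST V) (X : Finset V) : ℝ := ∑ v ∈ X, I.w v

/-- `Π(X)`, the total penalty of a vertex set. -/
def penalty {V : Type*} (I : NWPCST V) (X : Finset V) : ℝ := ∑ v ∈ X, I.π v

/-- A terminal is a vertex of positive penalty. -/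
def IsTerminal {V : Type*} (I : NWPCST V) (v : V) : Prop := 0 < I.π v

/-- A solution is (the vertex set of) a connected subgraph containing the root. -/
def IsSolution {V : Type*} (I : NWPCST V) (F : Finset V) : Prop :=
  I.r ∈ F ∧ (I.G.induce (F : Set V)).Connected

/-- The objective value of a solution. -/
def cost {V : Type*} [Fintype V] [DecidableEq V] (I : NWPCST V) (F : Finset V) : ℝ :=
  I.weight F + I.penalty Fᶜ

theorem isSolution_root {V : Type*} (I : NWPCST V) : I.IsSolution {I.r} := by
  refine ⟨by simp, ?_⟩
  rw [coe_singleton]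
  have : Subsingleton ({I.r} : Set V) := inferInstance
  exact { preconnected := fun a b => by rw [Subsingleton.elim a b]
          nonempty := ⟨⟨I.r, rfl⟩⟩ }

open Classical in
/-- `OPT`, the minimum objective value of a solution. -/
noncomputable def opt {V : Type*} [Fintype V] [DecidableEq V] (I : NWPCST V) : ℝ :=
  (univ.filter fun F : Finset V => I.IsSolution F).inf'
    ⟨{I.r}, by simpa using I.isSolution_root⟩ I.cost

open Classical in
/-- `Γ(S)`, the vertices outside `S` with a neighbour in `S`. -/
noncomputable def nbrs {V : Type*} [Fintype V] (I : NWPCST V) (S : Finset V) : Finset V :=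
  univ.filter fun v => v ∉ S ∧ ∃ u ∈ S, I.G.Adj u v

/-- The index set of the dual variables: all `S ⊆ V ∖ {r}`. -/
def dualSets {V : Type*} [Fintype V] [DecidableEq V] (I : NWPCST V) : Finset (Finset V) :=
  (univ.erase I.r).powerset

/-- The load `∑_{S : v ∈ Γ(S)} y_S` of a vertex, the left-hand side of its dual constraint. -/
noncomputable def load {V : Type*} [Fintype V] [DecidableEq V] (I : NWPCST V)
    (y : Finset V → ℝ) (v : V) : ℝ :=
  ∑ S ∈ I.dualSets with v ∈ I.nbrs S, y S

/-- Feasibility for the dual linear program. -/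
structure IsDualFeasible {V : Type*} [Fintype V] [DecidableEq V] (I : NWPCST V)
    (y : Finset V → ℝ) : Prop where
  nonneg : ∀ S ∈ I.dualSets, 0 ≤ y S
  vertex : ∀ v, I.load y v ≤ I.w v
  set : ∀ X ∈ I.dualSets, ∑ S ∈ X.powerset, y S ≤ I.penalty X

/-! ### The algorithm -/

open Classical in
/-- The vertex set of the connected component of `v` in the subgraph induced by `F` (empty if
`v ∉ F`): the vertices joined to `v` by a walk inside `F`. -/
noncomputable def comp {V : Type*} [Fintype V] (I : NWPCST V) (F : Finset V) (v : V) : Finset V :=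
  univ.filter fun u => ∃ p : I.G.Walk v u, ∀ x ∈ p.support, x ∈ F

/-- A state of the growth phase. -/
structure State (V : Type*) where
  /-- the number of the current iteration, used as the time -/
  time : ℕ
  /-- the vertices bought so far -/
  bought : Finset V
  /-- the vertices bought during the iterations, latest first, with the time of purchase;
  the vertices owned from the beginning are not listed -/
  purchases : List (V × ℕ)
  /-- the active moats; all other components of the bought vertices are inactive -/
  active : Finset (Finset V)
  /-- the time at which a terminal was marked, `⊤` for unmarked -/
  mark : V → ℕ∞
  /-- the dual variables -/
  y : Finset V → ℝ

open Classical in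
/-- At the beginning the terminals and the root are bought, all moats except the one of the root
are active, nothing is marked, and the dual variables are zero. -/
noncomputable def init {V : Type*} [Fintype V] [DecidableEq V] (I : NWPCST V) : State V :=
  let F : Finset V := univ.filter fun v => v = I.r ∨ I.IsTerminal v
  { time := 1
    bought := F
    purchases := []
    active := (F.image (I.comp F)).filter fun S => I.r ∉ S
    mark := fun _ => ⊤
    y := fun _ => 0 }

/-- The dual variables after all active moats have grown by `ε`. -/
def State.grow {V : Type*} [DecidableEq V] (s : State V) (ε : ℝ) : Finset V → ℝ :=
  fun S => if S ∈ s.active then s.y S + ε else s.y S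

open Classical in
/-- Grow by `ε` and buy `v`: the moats incident to `v` are merged into one moat, which is inactive
if it contains the root and active otherwise. -/
noncomputable def buy {V : Type*} [Fintype V] [DecidableEq V] (I : NWPCST V) (s : State V)
    (ε : ℝ) (v : V) : State V :=
  let M : Finset V := I.comp (insert v s.bought) v
  { time := s.time + 1
    bought := insert v s.bought
    purchases := (v, s.time) :: s.purchases
    active := (s.active.filter fun S => v ∉ I.nbrs S) ∪ (if I.r ∈ M then ∅ else {M})
    mark := s.mark
    y := s.grow ε }

open Classical in
/-- Grow by `ε` and make the moat `X` inactive: all unmarked terminals inside `X` are marked with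
the current time. -/
noncomputable def deactivate {V : Type*} [DecidableEq V] (I : NWPCST V) (s : State V)
    (ε : ℝ) (X : Finset V) : State V :=
  { time := s.time + 1
    bought := s.bought
    purchases := s.purchases
    active := s.active.erase X
    mark := fun u => if u ∈ X ∧ I.IsTerminal u ∧ s.mark u = ⊤ then (s.time : ℕ∞) else s.mark u
    y := s.grow ε }

/-- One iteration: as long as there are active moats, all of them grow uniformly, within the dual
constraints, until either the constraint of an unbought vertex or that of an active moat is tight,
and one such event is processed. Ties are broken arbitrarily. An unbought vertex that is tight but
not adjacent to an active moat (it was tight before the growth) can be bought only without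
growth. -/
inductive Step {V : Type*} [Fintype V] [DecidableEq V] (I : NWPCST V) : State V → State V → Prop
  | buy (s : State V) (ε : ℝ) (v : V) (hactive : s.active.Nonempty) (hε : 0 ≤ ε)
      (hfeas : I.IsDualFeasible (s.grow ε)) (hv : v ∉ s.bought)
      (htight : I.load (s.grow ε) v = I.w v)
      (hadj : ε = 0 ∨ ∃ S ∈ s.active, v ∈ I.nbrs S) :
      Step I s (I.buy s ε v)
  | deactivate (s : State V) (ε : ℝ) (X : Finset V) (hε : 0 ≤ ε)
      (hfeas : I.IsDualFeasible (s.grow ε)) (hX : X ∈ s.active)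
      (htight : ∑ S ∈ X.powerset, s.grow ε S = I.penalty X) :
      Step I s (I.deactivate s ε X)

/-- The states reachable in the growth phase. -/
def Reachable {V : Type*} [Fintype V] [DecidableEq V] (I : NWPCST V) (s : State V) : Prop :=
  Relation.ReflTransGen I.Step I.init s

open Classical in
/-- Pruning of `R` along a list of purchases (latest first). A vertex `v` of the current set,
bought at time `t`, is deleted, with everything that becomes disconnected from the root, if its
deletion disconnects no terminal of the current set that was unmarked at time `t`. -/
noncomputable def prune {V : Type*} [Fintype V] [DecidableEq V] (I : NWPCST V) (mark : V → ℕ∞) :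
    List (V × ℕ) → Finset V → Finset V
  | [], R => R
  | (v, t) :: l, R =>
    if v ∈ R ∧ ∀ u ∈ R, I.IsTerminal u → (t : ℕ∞) < mark u → u ∈ I.comp (R.erase v) I.r then
      prune I mark l (I.comp (R.erase v) I.r)
    else prune I mark l R

/-- The set output from the last state of the growth phase: the component of the root, pruned in
the reverse order of purchase. The vertices owned from the beginning need not be considered:
the root is kept, and the deletion of a terminal disconnects that terminal, which was unmarked
at the beginning. -/
noncomputable def output {V : Type*} [Fintype V] [DecidableEq V] (I : NWPCST V) (s : State V) :
    Finset V :=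
  I.prune s.mark s.purchases (I.comp s.bought I.r)

end NWPCST

/-! ### Circulations on planar graphs -/

section Circulation

set_option linter.unusedSectionVars false

open Finset Matrix

variable {V : Type*} [Fintype V] [DecidableEq V] (G : SimpleGraph V) [DecidableRel G.Adj]

/-! The proof is primal-dual. Bought vertices are tight, so the output `F'` weighs at most `∑ y_S
|F' ∩ Γ(S)|`. This is at most three times the sum of the `y_S` with `S` meeting `F'`
(`sum_mul_card_output_le`), while `Π(V ∖ F')` is at most the sum of the `y_S` with `S` disjoint from
`F'` (`GrowthInv.penalty_output_le`). Adding the first bound to three times the second gives the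
inequality with `3 ∑ y_S`; weak duality compares it with `OPT`.

For the penalties: a terminal outside `F'` was marked in a tight moat, that moat is lost as a whole
in the pruning, and unions of tight sets are tight.

For the weight, it suffices that in each step with positive growth the active moats meeting `F'`
have on average at most three neighbours in `F'` (`GrowthInv.sum_active_le`). Undo only the
purchases made from this step on: in the resulting set `R`, each remaining later vertex separates an
active moat from the root. Attach every moat and every later vertex to the last later vertex
separating it from the root. Each incidence then lies in the group of one such separator
(`sum_card_nbrs_le`). A group with `n ≥ 3` members is a simple bipartite planar minor and has at
most `2n - 4` incidences (`IsPlanar.card_adj_pairs_add_four_le`); the factor 3 is needed only for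
smaller groups.

The bipartite bound comes from linear algebra. Euler's equation forces the face boundaries to span
all circulations; hence a subgraph satisfies Euler's inequality for the regions it cuts out, and a
nonzero region boundary uses at least four edges of the minor. -/

/-- Antisymmetric functions on darts. -/
def antisymmDart : Submodule ℝ (G.Dart → ℝ) where
  carrier := {z | ∀ d : G.Dart, z d.symm = -z d}
  add_mem' {a b} ha hb d := by simp [ha d, hb d]; ring
  zero_mem' d := by simp
  smul_mem' c x hx d := by simp [hx d]

/-- The divergence of a function on darts. -/
def dartDiv : (G.Dart → ℝ) →ₗ[ℝ] (V → ℝ) where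
  toFun z v := ∑ d : G.Dart, if d.fst = v then z d else 0
  map_add' a b := by
    ext v
    simp only [Pi.add_apply, ← sum_add_distrib]
    exact sum_congr rfl fun d _ => by split_ifs <;> simp
  map_smul' c a := by
    ext v
    simp [mul_sum]

/-- The boundary map from functions on the faces (an isolated vertex being a face) to functions
on darts. -/
def faceBoundary (σ : Equiv.Perm G.Dart) :
    ((Quotient (Equiv.Perm.SameCycle.setoid (σ * dartReverse G)) → ℝ) ×
      ({v : V // ∀ u, ¬ G.Adj v u} → ℝ)) →ₗ[ℝ] (G.Dart → ℝ) where
  toFun x d := x.1 (Quotient.mk _ d) - x.1 (Quotient.mk _ d.symm)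
  map_add' a b := by ext d; simp; ring
  map_smul' c a := by ext d; simp; ring

theorem Equiv.Perm.SameCycle.apply_eq_of_invariant {α β : Type*} {σ : Equiv.Perm α} {c : α → β}
    (hc : ∀ d, c (σ d) = c d) {d e : α} (h : σ.SameCycle d e) : c d = c e := by
  obtain ⟨i, rfl⟩ := h
  induction i using Int.induction_on with
  | zero => simp
  | succ n ih => rw [add_comm, _root_.zpow_add, zpow_one, Equiv.Perm.mul_apply, hc, ih]
  | pred n ih =>
    rw [ih, ← hc ((σ ^ (-(n : ℤ) - 1)) d), ← Equiv.Perm.mul_apply, ← _root_.zpow_one_add,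
      add_sub_cancel]

variable {G}

theorem mk_rotate_eq {σ : Equiv.Perm G.Dart} (d : G.Dart) :
    (Quotient.mk (Equiv.Perm.SameCycle.setoid (σ * dartReverse G)) (σ d)) =
      Quotient.mk _ d.symm := by
  refine (Quotient.sound ?_).symm
  refine ⟨1, ?_⟩
  simp [dartReverse]

variable (G)

/-- Functions pulled back from edges are symmetric. They form a space of dimension `|E|` meeting the
antisymmetric one trivially, inside a space of dimension `2|E|`. -/
theorem finrank_antisymmDart_le : Module.finrank ℝ (antisymmDart G) ≤ #G.edgeFinset := by
  let f : (G.edgeSet → ℝ) →ₗ[ℝ] (G.Dart → ℝ) :=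
    LinearMap.funLeft ℝ ℝ (fun d : G.Dart => (⟨d.edge, d.edge_mem⟩ : G.edgeSet))
  have hf : Function.Injective f := by
    apply LinearMap.funLeft_injective_of_surjective
    rintro ⟨e, he⟩
    induction e using Sym2.ind with
    | _ a b => exact ⟨⟨(a, b), he⟩, rfl⟩
  have h1 : Module.finrank ℝ (LinearMap.range f) = #G.edgeFinset := by
    rw [LinearMap.finrank_range_of_inj hf, Module.finrank_fintype_fun_eq_card,
      SimpleGraph.edgeFinset_card]
  have h2 : Disjoint (antisymmDart G) (LinearMap.range f) := by
    rw [Submodule.disjoint_def]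
    rintro _ hx ⟨g, rfl⟩
    ext d
    have := hx d
    have h3 : f g d.symm = f g d := by
      simp only [f, LinearMap.funLeft_apply]
      congr 2
      exact d.edge_symm
    simp only [Pi.zero_apply]
    linarith
  have h3 := Submodule.finrank_add_finrank_le_of_disjoint h2
  rw [h1, Module.finrank_fintype_fun_eq_card, SimpleGraph.dart_card_eq_twice_card_edges] at h3
  omega

theorem dartDiv_grad (p : V → ℝ) :
    dartDiv G (fun d => p d.fst - p d.snd) = G.lapMatrix ℝ *ᵥ p := by
  ext v
  rw [SimpleGraph.lapMatrix_mulVec_apply]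
  simp only [dartDiv, LinearMap.coe_mk, AddHom.coe_mk]
  rw [← sum_filter, SimpleGraph.dart_fst_fiber,
    sum_image (fun a _ b _ h => G.dartOfNeighborSet_injective v h)]
  simp only [SimpleGraph.dartOfNeighborSet, sum_sub_distrib]
  congr 1
  · rw [sum_const, card_univ, SimpleGraph.card_neighborSet_eq_degree, nsmul_eq_mul]
  · exact (Finset.sum_subtype _ (fun u => by simp) p).symm

/-- The divergence of a gradient is the Laplacian, so the divergence has at least the rank of the
Laplacian, which is `|V|` minus the number of components. Rank-nullity does the rest. -/
theorem finrank_circulation_add_le :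
    Module.finrank ℝ (antisymmDart G ⊓ LinearMap.ker (dartDiv G) : Submodule ℝ (G.Dart → ℝ)) +
      Fintype.card V ≤ #G.edgeFinset + Nat.card G.ConnectedComponent := by
  classical
  set D := (dartDiv G) ∘ₗ (antisymmDart G).subtype with hD
  have h1 := D.finrank_range_add_finrank_ker
  have h2 : Module.finrank ℝ (LinearMap.ker D) =
      Module.finrank ℝ (antisymmDart G ⊓ LinearMap.ker (dartDiv G) : Submodule ℝ (G.Dart → ℝ)) := by
    rw [hD, LinearMap.ker_comp, ← Submodule.map_comap_subtype, Submodule.finrank_map_subtype_eq]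
  set L := Matrix.toLin' (G.lapMatrix ℝ) with hL
  have h3 := L.finrank_range_add_finrank_ker
  have h4 : LinearMap.range L ≤ LinearMap.range D := by
    rintro _ ⟨p, rfl⟩
    refine ⟨⟨fun d => p d.fst - p d.snd, fun d => by simp [SimpleGraph.Dart.symm]⟩, ?_⟩
    simp only [hD, LinearMap.comp_apply, Submodule.subtype_apply, dartDiv_grad, hL,
      Matrix.toLin'_apply]
  have h5 := Submodule.finrank_mono h4
  have h6 := finrank_antisymmDart_le G
  have h7 := G.card_connectedComponent_eq_finrank_ker_toLin'_lapMatrix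
  rw [← hL, ← Nat.card_eq_fintype_card] at h7
  rw [Module.finrank_fintype_fun_eq_card] at h3
  omega

variable {G}

/-- The darts `σ d` and `d.symm` lie on the same face, and `σ` permutes the darts leaving `v`, so
the two sums in the divergence at `v` agree. -/
theorem range_faceBoundary_le (σ : Equiv.Perm G.Dart) (hσ : IsRotationSystem G σ) :
    LinearMap.range (faceBoundary G σ) ≤ antisymmDart G ⊓ LinearMap.ker (dartDiv G) := by
  rintro _ ⟨x, rfl⟩
  refine ⟨fun d => by simp [faceBoundary], ?_⟩
  change dartDiv G _ = 0
  ext v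
  simp only [dartDiv, LinearMap.coe_mk, AddHom.coe_mk, faceBoundary, Pi.zero_apply]
  have hfst : ∀ d : G.Dart, (σ d).fst = d.fst := fun d =>
    ((hσ d (σ d)).1 ⟨1, by simp⟩).symm
  have h := Equiv.sum_comp σ (fun d : G.Dart => if d.fst = v then x.1 (Quotient.mk _ d) else 0)
  simp only [hfst, mk_rotate_eq] at h
  refine Eq.trans ?_ (sub_eq_zero.2 h.symm)
  rw [← sum_sub_distrib]
  exact sum_congr rfl fun d _ => by split_ifs <;> simp

theorem faceBoundary_ker_apply_eq {σ : Equiv.Perm G.Dart} (hσ : IsRotationSystem G σ)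
    {x} (hx : faceBoundary G σ x = 0) {d e : G.Dart} (hde : d.fst = e.fst) :
    x.1 (Quotient.mk _ d) = x.1 (Quotient.mk _ e) := by
  refine Equiv.Perm.SameCycle.apply_eq_of_invariant (σ := σ)
    (c := fun d => x.1 (Quotient.mk _ d)) (fun d => ?_) ((hσ d e).2 hde)
  have h := congrFun hx d
  simp only [faceBoundary, LinearMap.coe_mk, AddHom.coe_mk, Pi.zero_apply] at h
  simp only [mk_rotate_eq]
  linarith

/-- A face function with zero boundary is constant around each vertex. It thus descends to a vertex
function that is constant along edges, and such functions form the kernel of the Laplacian. -/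
theorem finrank_ker_faceBoundary_le (σ : Equiv.Perm G.Dart) (hσ : IsRotationSystem G σ) :
    Module.finrank ℝ (LinearMap.ker (faceBoundary G σ)) ≤ Nat.card G.ConnectedComponent := by
  classical
  let E : ((Quotient (Equiv.Perm.SameCycle.setoid (σ * dartReverse G)) → ℝ) ×
      ({v : V // ∀ u, ¬ G.Adj v u} → ℝ)) →ₗ[ℝ] (V → ℝ) :=
    { toFun := fun x v => if h : ∃ u, G.Adj v u then
          x.1 (Quotient.mk _ ⟨(v, h.choose), h.choose_spec⟩) else x.2 ⟨v, not_exists.1 h⟩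
      map_add' := fun a b => by
        ext v
        by_cases h : ∃ u, G.Adj v u <;> simp [h]
      map_smul' := fun c a => by
        ext v
        by_cases h : ∃ u, G.Adj v u <;> simp [h] }
  have hE : ∀ x, faceBoundary G σ x = 0 → ∀ d : G.Dart, E x d.fst = x.1 (Quotient.mk _ d) := by
    intro x hx d
    have h : ∃ u, G.Adj d.fst u := ⟨d.snd, d.adj⟩
    simp only [E, LinearMap.coe_mk, AddHom.coe_mk, h, dif_pos]
    exact faceBoundary_ker_apply_eq hσ hx rfl
  have hmap : ∀ x ∈ LinearMap.ker (faceBoundary G σ),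
      E x ∈ LinearMap.ker (Matrix.toLin' (G.lapMatrix ℝ)) := by
    intro x hx
    rw [LinearMap.mem_ker] at hx
    rw [LinearMap.mem_ker, Matrix.toLin'_apply, SimpleGraph.lapMatrix_mulVec_eq_zero_iff_forall_adj]
    intro i j hij
    have h1 := hE x hx ⟨(i, j), hij⟩
    have h2 := hE x hx (SimpleGraph.Dart.symm ⟨(i, j), hij⟩)
    have h := congrFun hx ⟨(i, j), hij⟩
    simp only [faceBoundary, LinearMap.coe_mk, AddHom.coe_mk, Pi.zero_apply] at h
    simp only [SimpleGraph.Dart.symm_mk, Prod.swap_prod_mk] at h1 h2 h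
    linarith
  have hinj : Function.Injective (E.restrict hmap) := by
    rw [injective_iff_map_eq_zero]
    rintro ⟨x, hx⟩ h0
    have h1 : E x = 0 := by simpa using congrArg Subtype.val h0
    rw [LinearMap.mem_ker] at hx
    ext q
    · induction q using Quotient.ind with
      | _ d => simpa [h1] using (hE x hx d).symm
    · have h2 := congrFun h1 q.1
      have h3 : ¬ ∃ u, G.Adj q.1 u := not_exists.2 q.2
      simpa [E, h3] using h2
  have := LinearMap.finrank_le_finrank_of_injective hinj
  rwa [← G.card_connectedComponent_eq_finrank_ker_toLin'_lapMatrix,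
    ← Nat.card_eq_fintype_card] at this

/-- In a planar graph every circulation is a difference of potentials of faces. -/
theorem IsPlanar.exists_face_potential (hG : IsPlanar G) :
    ∃ σ : Equiv.Perm G.Dart, IsRotationSystem G σ ∧ ∀ z ∈ antisymmDart G, dartDiv G z = 0 →
      ∃ c : G.Dart → ℝ, (∀ d, c (σ d) = c d.symm) ∧ ∀ d, z d = c d - c d.symm := by
  classical
  obtain ⟨σ, hσ, hχ⟩ := hG
  refine ⟨σ, hσ, fun z hz hz0 => ?_⟩
  have h1 := (faceBoundary G σ).finrank_range_add_finrank_ker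
  have h2 := finrank_ker_faceBoundary_le σ hσ
  have h3 := finrank_circulation_add_le G
  have h4 : Module.finrank ℝ ((Quotient (Equiv.Perm.SameCycle.setoid (σ * dartReverse G)) → ℝ) ×
      ({v : V // ∀ u, ¬ G.Adj v u} → ℝ)) = numFaces G σ := by
    rw [Module.finrank_prod, Module.finrank_fintype_fun_eq_card, Module.finrank_fintype_fun_eq_card,
      numFaces, Nat.card_eq_fintype_card, Nat.card_eq_fintype_card]
  rw [Nat.card_eq_fintype_card (α := V), Nat.card_eq_fintype_card (α := G.edgeSet),
    ← SimpleGraph.edgeFinset_card] at hχ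
  -- The boundaries have dimension at least `|faces| - c`, with `c` the number of components; by
  -- Euler's equation this is `|E| - |V| + c`, which bounds the dimension of the circulations.
  have h5 := Submodule.eq_of_le_of_finrank_le (range_faceBoundary_le σ hσ) (by omega)
  obtain ⟨x, rfl⟩ : z ∈ LinearMap.range (faceBoundary G σ) := by
    rw [h5]; exact ⟨hz, hz0⟩
  exact ⟨fun d => x.1 (Quotient.mk _ d), fun d => by simp only [mk_rotate_eq], fun d => rfl⟩

end Circulation

/-! ### Regions of a subgraph and Euler's inequality -/

section FaceClasses

open Finset

set_option linter.unusedSectionVars false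

variable {V : Type*} [Fintype V] [DecidableEq V] {G : SimpleGraph V} [DecidableRel G.Adj]

theorem sum_dartDiv (z : G.Dart → ℝ) (s : Finset V) :
    ∑ v ∈ s, dartDiv G z v = ∑ d : G.Dart, if d.fst ∈ s then z d else 0 := by
  simp only [dartDiv, LinearMap.coe_mk, AddHom.coe_mk]
  rw [sum_comm]
  refine sum_congr rfl fun d _ => ?_
  rw [sum_ite_eq]

/-- The net outflow of an antisymmetric function from a vertex set is carried by the darts that
leave the set. -/
theorem sum_dartDiv_eq_boundary {z : G.Dart → ℝ} (hz : z ∈ antisymmDart G) (s : Finset V) :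
    ∑ v ∈ s, dartDiv G z v = ∑ d : G.Dart with d.fst ∈ s ∧ d.snd ∉ s, z d := by
  -- Darts inside `s` cancel against their reversals.
  have h0 : ∑ d : G.Dart with d.fst ∈ s ∧ d.snd ∈ s, z d = 0 := by
    have h : ∑ d : G.Dart with d.fst ∈ s ∧ d.snd ∈ s, z d =
        ∑ d : G.Dart with d.fst ∈ s ∧ d.snd ∈ s, z d.symm := by
      refine sum_bij' (fun d _ => d.symm) (fun d _ => d.symm) ?_ ?_ ?_ ?_ ?_ <;>
        simp +contextual [SimpleGraph.Dart.symm]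
    rw [sum_congr rfl fun d _ => hz d, sum_neg_distrib] at h
    linarith
  rw [sum_dartDiv, ← sum_filter,
    ← sum_filter_add_sum_filter_not (univ.filter fun d : G.Dart => d.fst ∈ s) (fun d => d.snd ∈ s),
    filter_filter, filter_filter, h0, zero_add]

/-- Extension of a function on a set of darts to an antisymmetric function on all darts. -/
def antisymmExtend (J : Finset G.Dart) : (J → ℝ) →ₗ[ℝ] (G.Dart → ℝ) where
  toFun z d := (if h : d ∈ J then z ⟨d, h⟩ else 0) - (if h : d.symm ∈ J then z ⟨d.symm, h⟩ else 0)
  map_add' a b := by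
    ext d
    by_cases h1 : d ∈ J <;> by_cases h2 : d.symm ∈ J <;> (simp [h1, h2]; try ring)
  map_smul' c a := by
    ext d
    by_cases h1 : d ∈ J <;> by_cases h2 : d.symm ∈ J <;> (simp [h1, h2]; try ring)

theorem antisymmExtend_mem (J : Finset G.Dart) (z : J → ℝ) :
    antisymmExtend J z ∈ antisymmDart G := by
  intro d
  simp [antisymmExtend]

/-- The relation generating the regions into which the sphere is cut by the edges of `J`: darts of
the same face, or the two darts of an edge outside `J`. -/
inductive RegionRel (σ : Equiv.Perm G.Dart) (J : Finset G.Dart) : G.Dart → G.Dart → Prop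
  | rotate (d) : RegionRel σ J (σ d) d.symm
  | cross (d) (h : d ∉ J) (h' : d.symm ∉ J) : RegionRel σ J d d.symm

/-- The region of a dart. -/
def region (σ : Equiv.Perm G.Dart) (J : Finset G.Dart) (d : G.Dart) :
    Quotient (Relation.EqvGen.setoid (RegionRel σ J)) := Quotient.mk _ d

theorem region_rotate (σ : Equiv.Perm G.Dart) (J : Finset G.Dart) (d : G.Dart) :
    region σ J (σ d) = region σ J d.symm :=
  Quotient.sound (Relation.EqvGen.rel _ _ (.rotate d))

theorem region_cross (σ : Equiv.Perm G.Dart) (J : Finset G.Dart) {d : G.Dart} (h : d ∉ J)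
    (h' : d.symm ∉ J) : region σ J d = region σ J d.symm :=
  Quotient.sound (Relation.EqvGen.rel _ _ (.cross d h h'))

open Classical in
/-- The regions incident to edges of `J`. -/
noncomputable def regions (σ : Equiv.Perm G.Dart) (J : Finset G.Dart) :
    Finset (Quotient (Relation.EqvGen.setoid (RegionRel σ J))) :=
  J.image (region σ J) ∪ J.image (fun d => region σ J d.symm)

/-- The boundary of a region as a circulation. -/
noncomputable def regionBoundary (σ : Equiv.Perm G.Dart) (J : Finset G.Dart)
    (k : Quotient (Relation.EqvGen.setoid (RegionRel σ J))) (d : G.Dart) : ℝ :=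
  Set.indicator {k} (fun _ => 1) (region σ J d) - Set.indicator {k} (fun _ => 1) (region σ J d.symm)

theorem regionBoundary_mem (σ : Equiv.Perm G.Dart) (J : Finset G.Dart) (k) :
    regionBoundary σ J k ∈ antisymmDart G := by
  intro d
  simp [regionBoundary]

theorem regionBoundary_eq_zero {σ : Equiv.Perm G.Dart} {J : Finset G.Dart} {k} {d : G.Dart}
    (h : d ∉ J) (h' : d.symm ∉ J) : regionBoundary σ J k d = 0 := by
  simp [regionBoundary, region_cross σ J h h']

theorem dartDiv_regionBoundary {σ : Equiv.Perm G.Dart} (hσ : IsRotationSystem G σ)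
    (J : Finset G.Dart) (k) : dartDiv G (regionBoundary σ J k) = 0 := by
  classical
  ext v
  simp only [dartDiv, LinearMap.coe_mk, AddHom.coe_mk, regionBoundary, Pi.zero_apply]
  have hfst : ∀ d : G.Dart, (σ d).fst = d.fst := fun d =>
    ((hσ d (σ d)).1 ⟨1, by simp⟩).symm
  have h := Equiv.sum_comp σ
    (fun d : G.Dart => if d.fst = v then Set.indicator {k} (fun _ => (1 : ℝ)) (region σ J d) else 0)
  simp only [hfst, region_rotate] at h
  refine Eq.trans ?_ (sub_eq_zero.2 h.symm)
  rw [← sum_sub_distrib]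
  exact sum_congr rfl fun d _ => by split_ifs <;> simp

/-- A region with zero boundary is everything in its connected component. -/
theorem region_eq_of_regionBoundary_eq_zero {σ : Equiv.Perm G.Dart} (hσ : IsRotationSystem G σ)
    {J : Finset G.Dart} {k} (hk : regionBoundary σ J k = 0) {d e : G.Dart}
    (hd : region σ J d = k) (hde : G.Reachable d.fst e.fst) : region σ J e = k := by
  have hsymm : ∀ d : G.Dart, region σ J d = k → region σ J d.symm = k := by
    intro d hd
    have := congrFun hk d
    by_contra h
    simp [regionBoundary, hd, h] at this
  have hrot : ∀ d : G.Dart, (region σ J (σ d) = k) = (region σ J d = k) := by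
    intro d
    rw [region_rotate]
    exact propext ⟨fun h => by simpa using hsymm _ h, hsymm d⟩
  have hfst : ∀ d e : G.Dart, d.fst = e.fst → region σ J d = k → region σ J e = k := by
    intro d e h hd
    exact (Equiv.Perm.SameCycle.apply_eq_of_invariant (c := fun d => region σ J d = k) hrot
      ((hσ d e).2 h)) ▸ hd
  obtain ⟨p⟩ := hde
  generalize hu : d.fst = u at p
  generalize hv : e.fst = v at p
  induction p generalizing d with
  | nil => exact hfst d e (hu.trans hv.symm) hd
  | cons hadj p ih =>
    exact ih (d := SimpleGraph.Dart.symm ⟨(_, _), hadj⟩) (hsymm _ (hfst d ⟨(_, _), hadj⟩ hu hd)) rfl hv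

/-- Euler's inequality for the regions of a subgraph of a planar graph. -/
theorem IsPlanar.exists_card_add_two_le (hG : IsPlanar G) :
    ∃ σ : Equiv.Perm G.Dart, IsRotationSystem G σ ∧ ∀ (J : Finset G.Dart) (N : Finset V),
      J.Nonempty → (∀ d ∈ J, d.symm ∉ J) → (∀ d ∈ J, d.fst ∈ N ∧ d.snd ∈ N) →
      #J + 2 ≤ #N + #(regions σ J) := by
  classical
  obtain ⟨σ, hσ, H⟩ := hG.exists_face_potential
  refine ⟨σ, hσ, fun J N hJ hor hN => ?_⟩
  obtain ⟨d₀, hd₀⟩ := hJ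
  have hn₀ : d₀.fst ∈ N := (hN d₀ hd₀).1
  -- Conservation is imposed at all vertices of `N` but one, since the total divergence vanishes.
  -- This saves one unit of rank; the constants in the kernel of `L` save the other, hence the 2.
  let D : (J → ℝ) →ₗ[ℝ] (N.erase d₀.fst → ℝ) :=
    LinearMap.funLeft ℝ ℝ (fun v : N.erase d₀.fst => (v : V)) ∘ₗ dartDiv G ∘ₗ antisymmExtend J
  let L : (regions σ J → ℝ) →ₗ[ℝ] (J → ℝ) :=
    { toFun := fun f d => f ⟨region σ J d, by
          simp only [regions, mem_union, mem_image]; exact Or.inl ⟨d, d.2, rfl⟩⟩ -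
        f ⟨region σ J (d : G.Dart).symm, by
          simp only [regions, mem_union, mem_image]; exact Or.inr ⟨d, d.2, rfl⟩⟩
      map_add' := fun a b => by ext d; simp; ring
      map_smul' := fun c a => by ext d; simp; ring }
  have h1 := D.finrank_range_add_finrank_ker
  have h2 : Module.finrank ℝ (LinearMap.range D) ≤ #N - 1 := by
    refine (Submodule.finrank_le _).trans ?_
    rw [Module.finrank_fintype_fun_eq_card, Fintype.card_coe, card_erase_of_mem hn₀]
  rw [Module.finrank_fintype_fun_eq_card, Fintype.card_coe] at h1
  have h3 := L.finrank_range_add_finrank_ker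
  rw [Module.finrank_fintype_fun_eq_card, Fintype.card_coe] at h3
  have h4 : 0 < Module.finrank ℝ (LinearMap.ker L) := by
    rw [Module.finrank_pos_iff_exists_ne_zero]
    refine ⟨⟨fun _ => 1, ?_⟩, ?_⟩
    · rw [LinearMap.mem_ker]
      ext d
      simp [L]
    · intro h
      have h' := congrFun (congrArg Subtype.val h) ⟨region σ J d₀, by
          simp only [regions, mem_union, mem_image]; exact Or.inl ⟨d₀, hd₀, rfl⟩⟩
      simp at h'
  have h5 : LinearMap.ker D ≤ LinearMap.range L := by
    intro z hz
    have hz' : ∀ v ∈ N.erase d₀.fst, dartDiv G (antisymmExtend J z) v = 0 := by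
      intro v hv
      exact congrFun (LinearMap.mem_ker.1 hz) ⟨v, hv⟩
    have hoff : ∀ v ∉ N, dartDiv G (antisymmExtend J z) v = 0 := by
      intro v hv
      simp only [dartDiv, LinearMap.coe_mk, AddHom.coe_mk]
      refine sum_eq_zero fun d _ => ?_
      split_ifs with h
      · have h1 : d ∉ J := fun h' => hv (h ▸ (hN d h').1)
        have h2 : d.symm ∉ J := fun h' => hv (h ▸ (hN _ h').2)
        simp [antisymmExtend, h1, h2]
      · rfl
    have hall : dartDiv G (antisymmExtend J z) = 0 := by
      have hne : ∀ v ≠ d₀.fst, dartDiv G (antisymmExtend J z) v = 0 := fun v hv => by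
        by_cases h : v ∈ N
        · exact hz' v (mem_erase.2 ⟨hv, h⟩)
        · exact hoff v h
      have hs := sum_dartDiv_eq_boundary (antisymmExtend_mem J z) univ
      simp only [mem_univ, not_true_eq_false, and_false, filter_false, sum_empty] at hs
      rw [sum_eq_single d₀.fst (fun v _ hv => hne v hv) (by simp)] at hs
      ext v
      by_cases h : v = d₀.fst
      · rw [h, hs]; rfl
      · exact hne v h
    obtain ⟨c, hc1, hc2⟩ := H _ (antisymmExtend_mem J z) hall
    -- The circulation vanishes on edges outside `J`, so its face potential agrees across them and
    -- descends to regions.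
    have hlift : ∀ a b, RegionRel σ J a b → c a = c b := by
      intro a b hab
      cases hab with
      | rotate d => exact hc1 d
      | cross _ h h' =>
        have := hc2 a
        simp only [antisymmExtend, LinearMap.coe_mk, AddHom.coe_mk, h, h', dif_neg,
          not_false_eq_true] at this
        linarith
    have hlift' : ∀ a b, Relation.EqvGen (RegionRel σ J) a b → c a = c b := by
      intro a b h
      induction h with
      | rel _ _ h => exact hlift _ _ h
      | refl _ => rfl
      | symm _ _ _ ih => exact ih.symm
      | trans _ _ _ _ _ ih1 ih2 => exact ih1.trans ih2
    refine ⟨fun k => Quotient.lift c hlift' k.1, ?_⟩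
    ext ⟨d, hd⟩
    have := hc2 d
    simp only [antisymmExtend, LinearMap.coe_mk, AddHom.coe_mk, hd, hor d hd, dif_neg, dif_pos,
      not_false_eq_true, sub_zero] at this
    rw [this]
    rfl
  have h6 := Submodule.finrank_mono h5
  have h7 : 0 < #N := card_pos.2 ⟨_, hn₀⟩
  omega

end FaceClasses

/-! ### Edge bound for bipartite planar minors -/

section BipartiteMinor

open Finset

/-- Two distinct first coordinates occur, each with two second coordinates. This stands in for the
fact that a cycle in a simple bipartite graph has length at least four. -/
theorem four_le_card_of_no_leaf {α β : Type*} {s : Finset (α × β)} (hs : s.Nonempty)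
    (h1 : ∀ p ∈ s, ∃ p' ∈ s, p'.1 = p.1 ∧ p'.2 ≠ p.2)
    (h2 : ∀ p ∈ s, ∃ p' ∈ s, p'.2 = p.2 ∧ p'.1 ≠ p.1) : 4 ≤ #s := by
  classical
  obtain ⟨⟨a, q⟩, hp⟩ := hs
  obtain ⟨⟨a1, q1⟩, hp1, e1, n1⟩ := h1 _ hp
  obtain ⟨⟨a2, q2⟩, hp2, e2, n2⟩ := h2 _ hp
  obtain ⟨⟨a3, q3⟩, hp3, e3, n3⟩ := h1 _ hp2
  simp only at e1 e2 e3 n1 n2 n3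
  subst e1 e2 e3
  have hsub : {(a1, q2), (a1, q1), (a3, q2), (a3, q3)} ⊆ s := by
    intro x hx
    simp only [mem_insert, mem_singleton] at hx
    rcases hx with rfl | rfl | rfl | rfl <;> assumption
  refine le_trans (le_of_eq ?_) (card_le_card hsub)
  rw [card_insert_of_notMem, card_insert_of_notMem, card_insert_of_notMem, card_singleton] <;>
    simp [n1.symm, n2.symm, n3.symm]

variable {V : Type*} [DecidableEq V] {G : SimpleGraph V}

/-- A connected vertex set has a spanning tree directed towards a given root. -/
theorem exists_parent {S : Finset V} {ρ : V}
    (hS : ∀ x ∈ S, ∃ p : G.Walk x ρ, ∀ z ∈ p.support, z ∈ S) :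
    ∃ (par : V → V) (rank : V → ℕ), ∀ x ∈ S, x ≠ ρ →
      G.Adj x (par x) ∧ par x ∈ S ∧ rank (par x) < rank x := by
  -- Breadth-first search: the rank is the distance to `ρ` within `S`, and the parent is the second
  -- vertex of a shortest walk.
  let len : V → ℕ := fun x => sInf {n | ∃ p : G.Walk x ρ, (∀ z ∈ p.support, z ∈ S) ∧ p.length = n}
  have key : ∀ x, ∃ y, x ∈ S → x ≠ ρ → G.Adj x y ∧ y ∈ S ∧ len y < len x := by
    intro x
    by_cases hx : x ∈ S
    swap
    · exact ⟨x, fun h => absurd h hx⟩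
    by_cases hxρ : x = ρ
    · exact ⟨x, fun _ h => absurd hxρ h⟩
    obtain ⟨p₀, hp₀⟩ := hS x hx
    have hne : {n | ∃ p : G.Walk x ρ, (∀ z ∈ p.support, z ∈ S) ∧ p.length = n}.Nonempty :=
      ⟨_, p₀, hp₀, rfl⟩
    obtain ⟨p, hp, hlen⟩ := Nat.sInf_mem hne
    cases p with
    | nil => exact absurd rfl hxρ
    | @cons _ y _ hadj p' =>
      refine ⟨y, fun _ _ => ⟨hadj, ?_, ?_⟩⟩
      · exact hp y (by simp)
      · have h1 : len y ≤ p'.length := Nat.sInf_le ⟨p', fun z hz => hp z (by simp [hz]), rfl⟩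
        have h2 : len x = p'.length + 1 := by
          rw [← SimpleGraph.Walk.length_cons hadj p', hlen]
        omega
  choose par hpar using key
  exact ⟨par, len, fun x hx hxρ => hpar x hx hxρ⟩

variable [Fintype V] [DecidableRel G.Adj]

/-- The number of edges of a connected simple bipartite minor of a planar graph, one of whose colour
classes consists of single vertices. -/
theorem IsPlanar.card_adj_pairs_add_four_le (hG : IsPlanar G) {A : Finset (Finset V)}
    {Q : Finset V}
    (hconn : ∀ S ∈ A, ∃ ρ ∈ S, ∀ x ∈ S, ∃ p : G.Walk x ρ, ∀ z ∈ p.support, z ∈ S)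
    (hdisj : ∀ S ∈ A, ∀ T ∈ A, ∀ x ∈ S, x ∈ T → S = T) (hQ : ∀ S ∈ A, ∀ q ∈ Q, q ∉ S) {r : V}
    (hA : ∀ S ∈ A, ∀ x ∈ S, G.Reachable r x)
    {P : Finset (Finset V × V)}
    (hP : ∀ p ∈ P, p.1 ∈ A ∧ p.2 ∈ Q ∧ ∃ x ∈ p.1, G.Adj x p.2) (h3 : 3 ≤ #A + #Q) :
    #P + 4 ≤ 2 * (#A + #Q) := by
  classical
  obtain rfl | hPne := P.eq_empty_or_nonempty
  · simp; omega
  have hdart : ∀ p ∈ P, ∃ d : G.Dart, d.fst ∈ p.1 ∧ d.snd = p.2 := fun p hp => by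
    obtain ⟨-, -, x, hx, hadj⟩ := hP p hp
    exact ⟨⟨(x, p.2), hadj⟩, hx, rfl⟩
  have : Nonempty G.Dart := ⟨(hdart _ hPne.choose_spec).choose⟩
  have : Nonempty V := ⟨r⟩
  choose! wd hwfst hwsnd using hdart
  choose! ρ hρ hwalk using hconn
  have hpar : ∀ S, ∃ (par : V → V) (rank : V → ℕ), S ∈ A → ∀ x ∈ S, x ≠ ρ S →
      G.Adj x (par x) ∧ par x ∈ S ∧ rank (par x) < rank x := fun S => by
    by_cases hS : S ∈ A
    · obtain ⟨par, rank, h⟩ := exists_parent (hwalk S hS)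
      exact ⟨par, rank, fun _ => h⟩
    · exact ⟨id, 0, fun h => absurd h hS⟩
  choose par rank hpar using hpar
  set U : Finset V := A.biUnion id with hU
  have hUmem : ∀ x ∈ U, ∃ S, S ∈ A ∧ x ∈ S := fun x hx => by simpa [hU] using hx
  have hmemU : ∀ S ∈ A, ∀ x ∈ S, x ∈ U := fun S hS x hx => by
    rw [hU, mem_biUnion]; exact ⟨S, hS, hx⟩
  choose! cls hclsA hcls using hUmem
  have hcls_eq : ∀ S ∈ A, ∀ x ∈ S, cls x = S := fun S hS x hx =>
    hdisj _ (hclsA x (hmemU S hS x hx)) _ hS x (hcls x (hmemU S hS x hx)) hx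
  have hUQ : ∀ x ∈ U, x ∉ Q := fun x hx hq => hQ _ (hclsA x hx) x hq (hcls x hx)
  set T : Finset V := U \ A.image ρ with hT
  have hTU : ∀ x ∈ T, x ∈ U := fun x hx => (mem_sdiff.1 hx).1
  have hTne : ∀ x ∈ T, x ≠ ρ (cls x) := fun x hx h =>
    (mem_sdiff.1 hx).2 (mem_image.2 ⟨_, hclsA x (hTU x hx), h.symm⟩)
  have htd : ∀ x ∈ T, ∃ d : G.Dart, d.fst = x ∧ d.snd ∈ cls x ∧
      rank (cls x) d.snd < rank (cls x) x := fun x hx => by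
    obtain ⟨h1, h2, h3⟩ := hpar _ (hclsA x (hTU x hx)) x (hcls x (hTU x hx)) (hTne x hx)
    exact ⟨⟨(x, par (cls x) x), h1⟩, rfl, h2, h3⟩
  choose! td htfst htsnd htrank using htd
  have htU : ∀ x ∈ T, (td x).snd ∈ U := fun x hx =>
    hmemU _ (hclsA x (hTU x hx)) _ (htsnd x hx)
  have htcls : ∀ x ∈ T, cls (td x).snd = cls x := fun x hx =>
    hcls_eq _ (hclsA x (hTU x hx)) _ (htsnd x hx)
  have hwU : ∀ p ∈ P, (wd p).fst ∈ U := fun p hp => hmemU _ (hP p hp).1 _ (hwfst p hp)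
  have hwQ : ∀ p ∈ P, (wd p).snd ∈ Q := fun p hp => (hwsnd p hp).symm ▸ (hP p hp).2.1
  have hwcls : ∀ p ∈ P, cls (wd p).fst = p.1 := fun p hp =>
    hcls_eq _ (hP p hp).1 _ (hwfst p hp)
  have hwinj : Set.InjOn wd P := fun p hp p' hp' h =>
    Prod.ext (by rw [← hwcls p hp, ← hwcls p' hp', h]) (by rw [← hwsnd p hp, ← hwsnd p' hp', h])
  have htinj : Set.InjOn td T := fun x hx x' hx' h => by rw [← htfst x hx, ← htfst x' hx', h]
  -- Rather than contracting the classes, `J` keeps a spanning tree of each (`td`) besides one dart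
  -- per pair (`wd`). The `#U - #A` tree edges offset the extra vertices in Euler's inequality.
  set J : Finset G.Dart := P.image wd ∪ T.image td with hJ
  have hJmem : ∀ d, d ∈ J ↔ (∃ p ∈ P, wd p = d) ∨ ∃ x ∈ T, td x = d := by simp [hJ]
  have hJcard : #J = #P + #T := by
    rw [hJ, card_union_of_disjoint, card_image_of_injOn hwinj, card_image_of_injOn htinj]
    rw [disjoint_left]
    intro d hd hd'
    obtain ⟨p, hp, rfl⟩ := mem_image.1 hd
    obtain ⟨x, hx, h⟩ := mem_image.1 hd'
    exact hUQ _ (htU x hx) (h ▸ hwQ p hp)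
  have hTcard : #T + #A = #U := by
    have hsub : A.image ρ ⊆ U := fun x hx => by
      obtain ⟨S, hS, rfl⟩ := mem_image.1 hx
      exact hmemU S hS _ (hρ S hS)
    have hinj : Set.InjOn ρ A := fun S hS S' hS' h =>
      hdisj S hS S' hS' (ρ S) (hρ S hS) (h ▸ hρ S' hS')
    have := card_sdiff_add_card_eq_card hsub
    rwa [card_image_of_injOn hinj] at this
  have hNcard : #(U ∪ Q) = #U + #Q :=
    card_union_of_disjoint (disjoint_left.2 hUQ)
  have hJfst : ∀ d ∈ J, d.fst ∈ U := fun d hd => by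
    rcases (hJmem d).1 hd with ⟨p, hp, rfl⟩ | ⟨x, hx, rfl⟩
    · exact hwU p hp
    · exact (htfst x hx).symm ▸ hTU x hx
  have hJor : ∀ d ∈ J, d.symm ∉ J := fun d hd hd' => by
    have hs := hJfst _ hd'
    rcases (hJmem d).1 hd with ⟨p, hp, rfl⟩ | ⟨x, hx, rfl⟩
    · exact hUQ _ hs (hwQ p hp)
    rcases (hJmem _).1 hd' with ⟨p, hp, h⟩ | ⟨y, hy, h⟩
    · have := hwQ p hp
      rw [h] at this
      exact hUQ _ (hTU x hx) (htfst x hx ▸ this)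
    · have h1 : (td x).snd = y := by rw [← htfst y hy, h]; rfl
      have h2 : (td y).snd = x := by rw [← htfst x hx, h]; rfl
      have h4 := htcls x hx
      rw [h1] at h4
      have h5 := htrank x hx
      have h6 := htrank y hy
      rw [h1] at h5
      rw [h2, h4] at h6
      omega
  obtain ⟨σ, hσ, Hσ⟩ := hG.exists_card_add_two_le
  have hN := Hσ J (U ∪ Q) (by
      obtain ⟨p, hp⟩ := hPne
      exact ⟨wd p, (hJmem _).2 (Or.inl ⟨p, hp, rfl⟩)⟩) hJor (fun d hd => by
    refine ⟨mem_union_left _ (hJfst d hd), ?_⟩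
    rcases (hJmem d).1 hd with ⟨p, hp, rfl⟩ | ⟨x, hx, rfl⟩
    · exact mem_union_right _ (hwQ p hp)
    · exact mem_union_left _ (htU x hx))
  -- circulations supported on the edges of `J`
  have hout : ∀ b ∈ antisymmDart G, dartDiv G b = 0 → (∀ d, d ∉ J → d.symm ∉ J → b d = 0) →
      b ≠ 0 → 4 ≤ #{p ∈ P | b (wd p) ≠ 0} := by
    intro b hb hdiv hoff hne
    have hsymm : ∀ d, b d.symm = -b d := hb
    have hbal : ∀ s : Finset V, ∀ d : G.Dart, d.fst ∈ s → d.snd ∉ s → b d ≠ 0 →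
        ∃ e : G.Dart, e ≠ d ∧ e.fst ∈ s ∧ e.snd ∉ s ∧ b e ≠ 0 := by
      intro s d h1 h2 h3
      by_contra! hcon
      have h := sum_dartDiv_eq_boundary hb s
      rw [hdiv, sum_eq_single_of_mem d (by simp [h1, h2])] at h
      · simp at h
        exact h3 h.symm
      · intro e he hed
        simp only [mem_filter, mem_univ, true_and] at he
        exact hcon e hed he.1 he.2
    have hWne : ∃ p ∈ P, b (wd p) ≠ 0 := by
      by_contra! hW
      apply hne
      by_cases hTb : ∃ x ∈ T, b (td x) ≠ 0
      · exfalso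
        -- A circulation cannot live on tree edges alone: at a lower end `x` of maximal rank,
        -- conservation demands a second edge of the support, which must come from a child of larger
        -- rank.
        obtain ⟨x, hx, hmax⟩ := (T.filter fun x => b (td x) ≠ 0).exists_max_image
          (fun x => rank (cls x) x) (by
            obtain ⟨x, hx, h⟩ := hTb
            exact ⟨x, by simp [hx, h]⟩)
        rw [mem_filter] at hx
        obtain ⟨e, hed, he1, -, he⟩ := hbal {x} (td x) (by simp [htfst x hx.1])
          (by simpa [htfst x hx.1] using (td x).snd_ne_fst) hx.2
        rw [mem_singleton] at he1
        by_cases hJe : e ∈ J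
        · rcases (hJmem e).1 hJe with ⟨p, hp, rfl⟩ | ⟨y, hy, rfl⟩
          · exact he (hW p hp)
          · rw [htfst y hy] at he1
            exact hed (he1 ▸ rfl)
        · by_cases hJe' : e.symm ∈ J
          · have hbe : b e.symm ≠ 0 := by rw [hsymm]; simpa using he
            rcases (hJmem _).1 hJe' with ⟨p, hp, h⟩ | ⟨y, hy, h⟩
            · exact hbe (h ▸ hW p hp)
            · have h1 := hmax y (mem_filter.2 ⟨hy, h ▸ hbe⟩)
              have h2 := htrank y hy
              have h3 := htcls y hy
              have h4 : (td y).snd = x := by rw [h, ← he1]; rfl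
              rw [h4] at h2 h3
              rw [h3] at h1
              omega
          · exact he (hoff e hJe hJe')
      · push Not at hTb
        have hJ0 : ∀ d ∈ J, b d = 0 := fun d hd => by
          rcases (hJmem d).1 hd with ⟨p, hp, rfl⟩ | ⟨x, hx, rfl⟩
          · exact hW p hp
          · exact hTb x hx
        ext d
        by_cases h1 : d ∈ J
        · exact hJ0 d h1
        · by_cases h2 : d.symm ∈ J
          · have := hJ0 _ h2
            rw [hsymm] at this
            simpa using this
          · exact hoff d h1 h2
    -- Conservation on the whole class `p.1`, and then at the vertex `p.2`, shows that no pair in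
    -- the support is a leaf.
    refine four_le_card_of_no_leaf (hWne.imp fun p hp => by simpa using hp) ?_ ?_
    · intro p hp
      rw [mem_filter] at hp
      obtain ⟨e, hed, he1, he2, he⟩ := hbal p.1 (wd p) (hwfst p hp.1)
        (fun h => hUQ _ (hmemU _ (hP p hp.1).1 _ h) (hwQ p hp.1)) hp.2
      have heU := hmemU _ (hP p hp.1).1 _ he1
      by_cases hJe : e ∈ J
      · rcases (hJmem e).1 hJe with ⟨p', hp', rfl⟩ | ⟨y, hy, rfl⟩
        · have h1 : p'.1 = p.1 := by
            rw [← hwcls p' hp', hcls_eq _ (hP p hp.1).1 _ he1]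
          exact ⟨p', mem_filter.2 ⟨hp', he⟩, h1, fun h2 => hed (Prod.ext h1 h2 ▸ rfl)⟩
        · rw [htfst y hy] at he1
          exact absurd (hcls_eq _ (hP p hp.1).1 _ he1 ▸ htsnd y hy) he2
      · by_cases hJe' : e.symm ∈ J
        · rcases (hJmem _).1 hJe' with ⟨p', hp', h⟩ | ⟨y, hy, h⟩
          · have := hwQ p' hp'
            rw [h] at this
            exact absurd this (hUQ _ heU)
          · have h1 : (td y).snd = e.fst := by rw [h]; rfl
            have h2 : e.snd = y := by rw [← htfst y hy, h]; rfl
            have h3 := htcls y hy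
            rw [h1, hcls_eq _ (hP p hp.1).1 _ he1] at h3
            exact absurd (h2 ▸ h3 ▸ hcls y (hTU y hy)) he2
        · exact absurd (hoff e hJe hJe') he
    · intro p hp
      rw [mem_filter] at hp
      have hbp : b (wd p).symm ≠ 0 := by rw [hsymm]; simpa using hp.2
      obtain ⟨e, hed, he1, -, he⟩ := hbal {p.2} (wd p).symm (by simpa using hwsnd p hp.1)
        (by
          have := (wd p).fst_ne_snd
          rw [hwsnd p hp.1] at this
          simpa using this) hbp
      rw [mem_singleton] at he1
      have heQ : e.fst ∈ Q := he1.symm ▸ (hP p hp.1).2.1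
      have hJe : e ∉ J := fun h => hUQ _ (hJfst e h) heQ
      by_cases hJe' : e.symm ∈ J
      · have hbe : b e.symm ≠ 0 := by rw [hsymm]; simpa using he
        rcases (hJmem _).1 hJe' with ⟨p', hp', h⟩ | ⟨y, hy, h⟩
        · have h1 : p'.2 = p.2 := by rw [← hwsnd p' hp', h, ← he1]; rfl
          refine ⟨p', mem_filter.2 ⟨hp', h ▸ hbe⟩, h1, fun h2 => hed ?_⟩
          rw [← Prod.ext h2 h1, h, SimpleGraph.Dart.symm_symm]
        · have h1 : (td y).snd = e.fst := by rw [h]; rfl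
          exact absurd (h1 ▸ heQ) (hUQ _ (htU y hy))
      · exact absurd (hoff e hJe hJe') he
  have hdr : ∀ d ∈ J, G.Reachable r d.fst := fun d hd =>
    hA _ (hclsA _ (hJfst d hd)) _ (hcls _ (hJfst d hd))
  have hreg : ∀ k ∈ regions σ J, ∃ d : G.Dart, G.Reachable r d.fst ∧ region σ J d = k := by
    intro k hk
    simp only [regions, mem_union, mem_image] at hk
    rcases hk with ⟨d, hd, rfl⟩ | ⟨d, hd, rfl⟩
    · exact ⟨d, hdr d hd, rfl⟩
    · exact ⟨d.symm, (hdr d hd).trans d.adj.reachable, rfl⟩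
  -- A zero boundary means that `J` does not cut its component: there is a single region, and `3 ≤
  -- #A + #Q` suffices. Otherwise each region has at least four edges of `P` on its boundary and
  -- each such edge borders at most two regions.
  by_cases hzero : ∃ k ∈ regions σ J, regionBoundary σ J k = 0
  · obtain ⟨k, hk, hk0⟩ := hzero
    have hone : #(regions σ J) ≤ 1 := by
      refine (card_le_card (t := {k}) fun k' hk' => mem_singleton.2 ?_).trans (card_singleton k).le
      obtain ⟨d, hd, rfl⟩ := hreg k hk
      obtain ⟨e, he, rfl⟩ := hreg k' hk'
      exact region_eq_of_regionBoundary_eq_zero hσ hk0 rfl (hd.symm.trans he)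
    omega
  · push Not at hzero
    have h1 : #(regions σ J) * 4 ≤
        ∑ k ∈ regions σ J, #{p ∈ P | regionBoundary σ J k (wd p) ≠ 0} := by
      rw [← smul_eq_mul]
      exact card_nsmul_le_sum _ _ _ fun k hk => hout _ (regionBoundary_mem σ J k)
        (dartDiv_regionBoundary hσ J k) (fun d => regionBoundary_eq_zero) (hzero k hk)
    have h2 : ∑ k ∈ regions σ J, #{p ∈ P | regionBoundary σ J k (wd p) ≠ 0} ≤ #P * 2 := by
      simp only [card_filter]
      rw [sum_comm, ← smul_eq_mul]
      refine sum_le_card_nsmul _ _ _ fun p _ => ?_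
      rw [← card_filter]
      refine le_trans (card_le_card (t := {region σ J (wd p), region σ J (wd p).symm}) ?_)
        card_le_two
      intro k hk
      rw [mem_filter] at hk
      by_contra h
      simp only [mem_insert, mem_singleton, not_or] at h
      exact hk.2 (by simp [regionBoundary, Ne.symm h.1, Ne.symm h.2])
    omega

end BipartiteMinor

namespace NWPCST

open Finset

/-! ### Components of induced subgraphs -/

section Comp

set_option linter.unusedSectionVars false

variable {V : Type*} [Fintype V] [DecidableEq V] (I : NWPCST V)

theorem mem_comp {F : Finset V} {u v : V} :
    u ∈ I.comp F v ↔ ∃ p : I.G.Walk v u, ∀ x ∈ p.support, x ∈ F := by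
  simp [comp]

variable {I}

theorem comp_subset (F : Finset V) (v : V) : I.comp F v ⊆ F := fun u hu => by
  obtain ⟨p, hp⟩ := I.mem_comp.1 hu
  exact hp u p.end_mem_support

theorem start_mem_of_mem_comp {F : Finset V} {u v : V} (h : u ∈ I.comp F v) : v ∈ F := by
  obtain ⟨p, hp⟩ := I.mem_comp.1 h
  exact hp v p.start_mem_support

theorem mem_comp_self {F : Finset V} {v : V} (h : v ∈ F) : v ∈ I.comp F v :=
  I.mem_comp.2 ⟨.nil, by simpa using h⟩

theorem mem_comp_symm {F : Finset V} {u v : V} (h : u ∈ I.comp F v) : v ∈ I.comp F u := by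
  obtain ⟨p, hp⟩ := I.mem_comp.1 h
  exact I.mem_comp.2 ⟨p.reverse, by simpa using hp⟩

theorem mem_comp_trans {F : Finset V} {u v x : V} (h : u ∈ I.comp F v) (h' : x ∈ I.comp F u) :
    x ∈ I.comp F v := by
  obtain ⟨p, hp⟩ := I.mem_comp.1 h
  obtain ⟨q, hq⟩ := I.mem_comp.1 h'
  refine I.mem_comp.2 ⟨p.append q, fun y hy => ?_⟩
  rw [SimpleGraph.Walk.mem_support_append_iff] at hy
  exact hy.elim (hp y) (hq y)

theorem comp_eq_of_mem {F : Finset V} {u v : V} (h : u ∈ I.comp F v) : I.comp F u = I.comp F v := by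
  ext x
  exact ⟨mem_comp_trans h, mem_comp_trans (mem_comp_symm h)⟩

theorem mem_comp_of_adj {F : Finset V} {u v x : V} (h : u ∈ I.comp F v) (hadj : I.G.Adj u x)
    (hx : x ∈ F) : x ∈ I.comp F v := by
  refine mem_comp_trans h (I.mem_comp.2 ⟨hadj.toWalk, fun y hy => ?_⟩)
  have : y = u ∨ y = x := by simpa using hy
  rcases this with rfl | rfl
  · exact comp_subset _ _ h
  · exact hx

theorem comp_mono {F F' : Finset V} (h : F ⊆ F') (v : V) : I.comp F v ⊆ I.comp F' v := fun u hu => by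
  obtain ⟨p, hp⟩ := I.mem_comp.1 hu
  exact I.mem_comp.2 ⟨p, fun x hx => h (hp x hx)⟩

/-- A vertex set closed under adjacency within `F` contains every component of `F` it meets. -/
theorem comp_subset_of_closed {F X : Finset V} {v : V} (hv : v ∈ X)
    (hX : ∀ a ∈ X, ∀ b ∈ F, I.G.Adj a b → b ∈ X) : I.comp F v ⊆ X := fun u hu => by
  obtain ⟨p, hp⟩ := I.mem_comp.1 hu
  induction p with
  | nil => exact hv
  | cons hadj p ih =>
    have hp' : ∀ x ∈ p.support, x ∈ F := fun x hx => hp x (by simp [hx])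
    exact ih (hX _ hv _ (hp' _ p.start_mem_support) hadj) (I.mem_comp.2 ⟨p, hp'⟩) hp'

theorem mem_comp_comp {F : Finset V} {u v : V} (h : u ∈ I.comp F v) :
    u ∈ I.comp (I.comp F v) v := by
  have hv : v ∈ I.comp F v := mem_comp_self (start_mem_of_mem_comp h)
  refine comp_subset_of_closed (X := I.comp (I.comp F v) v) (mem_comp_self hv) ?_ h
  intro a ha b hb hadj
  exact mem_comp_of_adj ha hadj (mem_comp_of_adj (comp_subset _ _ ha) hadj hb)

theorem mem_nbrs {S : Finset V} {v : V} : v ∈ I.nbrs S ↔ v ∉ S ∧ ∃ u ∈ S, I.G.Adj u v := by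
  simp [nbrs]

theorem comp_insert_of_notMem_nbrs {F : Finset V} {v x : V} (hx : x ∈ F) (hv : v ∉ F)
    (h : v ∉ I.nbrs (I.comp F x)) : I.comp (insert v F) x = I.comp F x := by
  refine subset_antisymm (comp_subset_of_closed (mem_comp_self hx) ?_)
    (comp_mono (subset_insert _ _) x)
  intro a ha b hb hadj
  rcases mem_insert.1 hb with rfl | hb
  · exact absurd (mem_nbrs.2 ⟨fun h' => hv (comp_subset _ _ h'), a, ha, hadj⟩) h
  · exact mem_comp_of_adj ha hadj hb

theorem isSolution_of_forall_mem_comp {F : Finset V} (hr : I.r ∈ F)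
    (h : ∀ x ∈ F, x ∈ I.comp F I.r) : I.IsSolution F := by
  refine ⟨hr, ?_⟩
  have key : ∀ x : (F : Set V), (I.G.induce (F : Set V)).Reachable ⟨I.r, hr⟩ x := by
    rintro ⟨x, hx⟩
    obtain ⟨p, hp⟩ := I.mem_comp.1 (h x hx)
    exact ⟨p.induce (F : Set V) hp⟩
  exact { preconnected := fun a b => (key a).symm.trans (key b)
          nonempty := ⟨⟨I.r, hr⟩⟩ }

theorem IsSolution.mem_comp {F : Finset V} (h : I.IsSolution F) {x : V} (hx : x ∈ F) :
    x ∈ I.comp F I.r := by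
  obtain ⟨p⟩ := h.2.preconnected ⟨I.r, h.1⟩ ⟨x, hx⟩
  refine I.mem_comp.2 ⟨p.map (SimpleGraph.Embedding.induce (F : Set V)).toHom, fun y hy => ?_⟩
  obtain ⟨z, -, rfl⟩ := List.mem_map.1 ((SimpleGraph.Walk.support_map _ p) ▸ hy)
  exact z.2

end Comp

/-! ### Pruning -/

section Prune

variable {V : Type*} [Fintype V] [DecidableEq V] {I : NWPCST V} {mark : V → ℕ∞}

/-- The deletion of `v`, bought at time `t`, is permitted. -/
def Deletable (I : NWPCST V) (mark : V → ℕ∞) (R : Finset V) (v : V) (t : ℕ) : Prop :=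
  v ∈ R ∧ ∀ u ∈ R, I.IsTerminal u → (t : ℕ∞) < mark u → u ∈ I.comp (R.erase v) I.r

theorem prune_cons_of_deletable {R : Finset V} {p : V × ℕ} {l : List (V × ℕ)}
    (h : I.Deletable mark R p.1 p.2) :
    I.prune mark (p :: l) R = I.prune mark l (I.comp (R.erase p.1) I.r) := by
  rw [prune]
  exact if_pos h

theorem prune_cons_of_not_deletable {R : Finset V} {p : V × ℕ} {l : List (V × ℕ)}
    (h : ¬ I.Deletable mark R p.1 p.2) : I.prune mark (p :: l) R = I.prune mark l R := by
  rw [prune]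
  exact if_neg h

theorem comp_erase_subset (R : Finset V) (v : V) : I.comp (R.erase v) I.r ⊆ R :=
  (comp_subset _ _).trans (erase_subset _ _)

/-- Invariants of the pruning phase. -/
theorem prune_induction {motive : Finset V → Prop} {l : List (V × ℕ)} {R : Finset V}
    (hR : motive R)
    (step : ∀ p ∈ l, ∀ R, motive R → I.Deletable mark R p.1 p.2 →
      motive (I.comp (R.erase p.1) I.r)) : motive (I.prune mark l R) := by
  induction l generalizing R with
  | nil => exact hR
  | cons p l ih =>
    by_cases h : I.Deletable mark R p.1 p.2
    · rw [prune_cons_of_deletable h]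
      exact ih (step p (by simp) R hR h) fun q hq => step q (by simp [hq])
    · rw [prune_cons_of_not_deletable h]
      exact ih hR fun q hq => step q (by simp [hq])

theorem prune_append (l l' : List (V × ℕ)) (R : Finset V) :
    I.prune mark (l ++ l') R = I.prune mark l' (I.prune mark l R) := by
  induction l generalizing R with
  | nil => rfl
  | cons p l ih =>
    by_cases h : I.Deletable mark R p.1 p.2
    · rw [List.cons_append, prune_cons_of_deletable h, prune_cons_of_deletable h, ih]
    · rw [List.cons_append, prune_cons_of_not_deletable h, prune_cons_of_not_deletable h, ih]

theorem prune_subset (l : List (V × ℕ)) (R : Finset V) : I.prune mark l R ⊆ R :=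
  prune_induction (motive := fun R' => R' ⊆ R) subset_rfl
    fun _ _ R' hR' _ => (comp_erase_subset R' _).trans hR'

theorem root_mem_prune {l : List (V × ℕ)} {R : Finset V} (hl : ∀ p ∈ l, p.1 ≠ I.r) (hR : I.r ∈ R) :
    I.r ∈ I.prune mark l R :=
  prune_induction (motive := fun R' => I.r ∈ R') hR
    fun p hp _ hR' _ => mem_comp_self (mem_erase.2 ⟨(hl p hp).symm, hR'⟩)

theorem mem_comp_prune {l : List (V × ℕ)} {R : Finset V} (hR : ∀ x ∈ R, x ∈ I.comp R I.r) :
    ∀ x ∈ I.prune mark l R, x ∈ I.comp (I.prune mark l R) I.r :=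
  prune_induction (motive := fun R' => ∀ x ∈ R', x ∈ I.comp R' I.r) hR
    fun _ _ _ _ _ _ hx => mem_comp_comp hx

/-- Deleting a vertex outside `B` never separates a surviving vertex from an adjacent one in `B`.
With `B` the set bought at an earlier state, moats of that state survive or vanish as a whole. -/
theorem prune_closed {l : List (V × ℕ)} {R B : Finset V} (hl : ∀ p ∈ l, p.1 ∉ B)
    (hR : ∀ a ∈ R, ∀ b ∈ B, I.G.Adj a b → b ∈ R) :
    ∀ a ∈ I.prune mark l R, ∀ b ∈ B, I.G.Adj a b → b ∈ I.prune mark l R := by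
  refine prune_induction (motive := fun R' => ∀ a ∈ R', ∀ b ∈ B, I.G.Adj a b → b ∈ R') hR ?_
  intro p hp R' hR' _ a ha b hb hadj
  refine mem_comp_of_adj ha hadj (mem_erase.2 ⟨?_, hR' a (comp_erase_subset _ _ ha) b hb hadj⟩)
  rintro rfl
  exact hl p hp hb

theorem mem_prune_of_unmarked {l : List (V × ℕ)} {R : Finset V} {u : V} (hu : I.IsTerminal u)
    (hl : ∀ p ∈ l, (p.2 : ℕ∞) < mark u) (hR : u ∈ R) : u ∈ I.prune mark l R :=
  prune_induction (motive := fun R' => u ∈ R') hR fun p hp _ hR' h => h.2 u hR' hu (hl p hp)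

/-- A vertex that is kept separates a kept terminal, which was unmarked at the time of purchase,
from the root. -/
theorem exists_separated_of_mem_prune {l : List (V × ℕ)} {R : Finset V}
    (hl : l.Pairwise fun p q => q.2 < p.2) {p : V × ℕ} (hp : p ∈ l)
    (hv : p.1 ∈ I.prune mark l R) :
    ∃ u ∈ I.prune mark l R, I.IsTerminal u ∧ (p.2 : ℕ∞) < mark u ∧
      u ∉ I.comp ((I.prune mark l R).erase p.1) I.r := by
  induction l generalizing R with
  | nil => simp at hp
  | cons q l ih =>
    rw [List.pairwise_cons] at hl
    by_cases h : I.Deletable mark R q.1 q.2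
    · rw [prune_cons_of_deletable h] at hv ⊢
      rcases List.mem_cons.1 hp with rfl | hp
      · exact absurd (comp_subset _ _ (prune_subset _ _ hv)) (by simp)
      · exact ih hl.2 hp hv
    · rw [prune_cons_of_not_deletable h] at hv ⊢
      rcases List.mem_cons.1 hp with rfl | hp
      · have h' : ∃ u ∈ R, I.IsTerminal u ∧ (p.2 : ℕ∞) < mark u ∧
            u ∉ I.comp (R.erase p.1) I.r := by
          by_contra! hcon
          exact h ⟨prune_subset _ _ hv, hcon⟩
        obtain ⟨u, huR, hu, hmu, hsep⟩ := h'
        -- The remaining purchases are earlier, so `u` was unmarked then too and survives; shrinking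
        -- the set preserves the separation.
        refine ⟨u, mem_prune_of_unmarked hu (fun q hq => ?_) huR, hu, hmu, fun h'' => hsep ?_⟩
        · exact lt_trans (by exact_mod_cast hl.1 q hq) hmu
        · exact comp_mono (erase_subset_erase _ (prune_subset _ _)) _ h''
      · exact ih hl.2 hp hv

/-- A connected set containing a deleted terminal is deleted completely, if no vertex of the set was
bought after the terminal was marked. -/
theorem disjoint_prune {l : List (V × ℕ)} {R X : Finset V} (hl : l.Pairwise fun p q => q.2 < p.2)
    {u : V} (hu : I.IsTerminal u) (hX : ∀ x ∈ X, x ∈ I.comp X u)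
    (hlX : ∀ p ∈ l, mark u ≤ p.2 → p.1 ∉ X) (hXR : ∀ x ∈ X, x ∈ R → X ⊆ R) (huX : u ∈ X)
    (hdel : u ∉ I.prune mark l R) : ∀ x ∈ X, x ∉ I.prune mark l R := by
  induction l generalizing R with
  | nil => exact fun x hx hxR => hdel (hXR x hx hxR huX)
  | cons p l ih =>
    rw [List.pairwise_cons] at hl
    by_cases h : I.Deletable mark R p.1 p.2
    · rw [prune_cons_of_deletable h] at hdel ⊢
      by_cases hXR' : X ⊆ R
      swap
      · exact fun x hx hx' => hXR' (hXR x hx (comp_erase_subset _ _ (prune_subset _ _ hx')))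
      -- If `p.1` was bought before `u` was marked, `u` is protected now and at all remaining,
      -- earlier purchases. Otherwise `p.1` is not in `X`, so the connected set `X` is kept or cut
      -- off as a whole.
      rcases lt_or_ge (p.2 : ℕ∞) (mark u) with hlt | hle
      · refine absurd (mem_prune_of_unmarked hu (fun q hq => ?_) (h.2 u (hXR' huX) hu hlt)) hdel
        exact lt_trans (by exact_mod_cast hl.1 q hq) hlt
      · refine ih hl.2 (fun q hq => hlX q (by simp [hq])) ?_ hdel
        intro x hx hx' y hy
        have hsub : X ⊆ R.erase p.1 := fun z hz => mem_erase.2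
          ⟨fun hz' => hlX p (by simp) hle (hz' ▸ hz), hXR' hz⟩
        refine mem_comp_trans hx' (comp_mono hsub _ ?_)
        exact mem_comp_trans (mem_comp_symm (hX x hx)) (hX y hy)
    · rw [prune_cons_of_not_deletable h] at hdel ⊢
      exact ih hl.2 (fun q hq => hlX q (by simp [hq])) hXR hdel

end Prune

end NWPCST

namespace NWPCST

open Finset

/-! ### Separators and the count of incidences -/

section Separators

set_option linter.unusedSectionVars false

variable {V : Type*} [Fintype V] [DecidableEq V] (I : NWPCST V) (R Q : Finset V)

open Classical in
/-- The vertices of `Q` that separate `x` from the root in `R`. -/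
noncomputable def separators (x : V) : Finset V :=
  {q ∈ Q | q ≠ x ∧ x ∉ I.comp (R.erase q) I.r}

/-- The last of a set of separators: the one which leaves the largest component of the root. -/
noncomputable def lastSeparator (D : Finset V) : Option V :=
  if h : D.Nonempty then
    some (D.exists_max_image (fun q => #(I.comp (R.erase q) I.r)) h).choose
  else none

variable {I R Q}

theorem mem_separators {q x : V} :
    q ∈ I.separators R Q x ↔ q ∈ Q ∧ q ≠ x ∧ x ∉ I.comp (R.erase q) I.r := by
  simp [separators]

theorem lastSeparator_spec {D : Finset V} (hD : D.Nonempty) :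
    ∃ q ∈ D, I.lastSeparator R D = some q ∧
      ∀ q' ∈ D, #(I.comp (R.erase q') I.r) ≤ #(I.comp (R.erase q) I.r) := by
  have h := (D.exists_max_image (fun q => #(I.comp (R.erase q) I.r)) hD).choose_spec
  exact ⟨_, h.1, by rw [lastSeparator, dif_pos hD], h.2⟩

theorem mem_of_lastSeparator_eq {D : Finset V} {q : V} (h : I.lastSeparator R D = some q) :
    q ∈ D := by
  obtain hD | hD := D.eq_empty_or_nonempty
  · simp [lastSeparator, hD] at h
  · obtain ⟨q', hq', h', -⟩ := I.lastSeparator_spec (R := R) hD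
    rw [h] at h'
    exact Option.some.inj h' ▸ hq'

variable (hconn : ∀ x ∈ R, x ∈ I.comp R I.r)
include hconn

/-- Of two distinct vertices, one is reached from the root without the other. -/
theorem not_separated_both {q q' x : V} (hx : x ∈ R) (hxq : x ∉ I.comp (R.erase q) I.r)
    (hxq' : x ∉ I.comp (R.erase q') I.r) (hr : I.r ∈ R) (hrq : I.r ≠ q) :
    q ∉ I.comp (R.erase q') I.r ∨ q' ∉ I.comp (R.erase q) I.r := by
  by_contra! h
  -- If each of `q`, `q'` were reachable avoiding the other, the union of the two root components
  -- would be closed in `R`, hence contain `x`.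
  have hsub := comp_subset_of_closed (I := I) (F := R) (v := I.r)
    (X := I.comp (R.erase q) I.r ∪ I.comp (R.erase q') I.r)
    (mem_union_left _ (mem_comp_self (mem_erase.2 ⟨hrq, hr⟩))) ?_ (hconn x hx)
  · exact (mem_union.1 hsub).elim hxq hxq'
  · intro a ha b hb hadj
    rcases mem_union.1 ha with ha | ha
    · by_cases hbq : b = q
      · exact mem_union_right _ (hbq ▸ h.1)
      · exact mem_union_left _ (mem_comp_of_adj ha hadj (mem_erase.2 ⟨hbq, hb⟩))
    · by_cases hbq : b = q'
      · exact mem_union_left _ (hbq ▸ h.2)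
      · exact mem_union_right _ (mem_comp_of_adj ha hadj (mem_erase.2 ⟨hbq, hb⟩))

/-- The root component without `q'` avoids `q`, so it survives the removal of `q`. Equality would
make it closed in all of `R`, forcing it to contain `q`. Thus component size orders separators by
their distance along the chain from the root. -/
theorem card_comp_lt_of_separated {q q' : V} (hq : q ∈ R) (hne : q ≠ q')
    (hr : I.r ∈ R) (hsep : q ∉ I.comp (R.erase q') I.r) (hq'r : I.r ≠ q') :
    #(I.comp (R.erase q') I.r) < #(I.comp (R.erase q) I.r) := by
  have hsub : I.comp (R.erase q') I.r ⊆ I.comp (R.erase q) I.r := by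
    intro x hx
    refine comp_mono ?_ _ (mem_comp_comp hx)
    intro y hy
    exact mem_erase.2 ⟨fun h => hsep (h ▸ hy), comp_erase_subset _ _ hy⟩
  refine card_lt_card (hsub.ssubset_of_ne fun heq => ?_)
  refine hsep (comp_subset_of_closed (F := R) (v := I.r)
    (mem_comp_self (mem_erase.2 ⟨hq'r, hr⟩)) ?_ (hconn q hq))
  intro a ha b hb hadj
  by_cases hbq : b = q'
  · rw [heq] at ha ⊢
    exact mem_comp_of_adj ha hadj (mem_erase.2 ⟨fun h => hne (h.symm.trans hbq), hb⟩)
  · exact mem_comp_of_adj ha hadj (mem_erase.2 ⟨hbq, hb⟩)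

omit hconn in
theorem separators_erase_of_adj (hQR : Q ⊆ R) {q x : V} (hq : q ∈ Q) (hx : x ∈ R)
    (hxQ : x ∉ Q) (hadj : I.G.Adj x q) :
    (I.separators R Q x).erase q = I.separators R Q q := by
  ext d
  simp only [mem_erase, mem_separators]
  constructor
  · rintro ⟨h1, h2, h3, h4⟩
    exact ⟨h2, h1, fun h => h4 (mem_comp_of_adj h hadj.symm (mem_erase.2 ⟨h3.symm, hx⟩))⟩
  · rintro ⟨h1, h2, h3⟩
    have hdx : d ≠ x := fun h => hxQ (h ▸ h1)
    exact ⟨h2, h1, hdx, fun h => h3 (mem_comp_of_adj h hadj (mem_erase.2 ⟨h2.symm, hQR hq⟩))⟩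

/-- Apart from `q` itself, adjacent `x` and `q` have the same separators. If `q` separates `x`, all
the others separate `q` and so precede it. This confines each incidence to one group. -/
theorem lastSeparator_of_adj (hr : I.r ∈ R) (hQR : Q ⊆ R) (hrQ : I.r ∉ Q) {q x : V} (hq : q ∈ Q)
    (hx : x ∈ R) (hxQ : x ∉ Q) (hadj : I.G.Adj x q) :
    I.lastSeparator R (I.separators R Q x) = some q ∨
      I.lastSeparator R (I.separators R Q x) = I.lastSeparator R (I.separators R Q q) := by
  have hE := separators_erase_of_adj (I := I) hQR hq hx hxQ hadj
  by_cases hqx : q ∈ I.separators R Q x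
  · left
    obtain ⟨q', hq', heq, hmax⟩ := I.lastSeparator_spec (R := R) ⟨q, hqx⟩
    rw [heq]
    by_contra hne
    have hne' : q' ≠ q := fun h => hne (h ▸ rfl)
    have h1 : q' ∈ I.separators R Q q := hE ▸ mem_erase.2 ⟨hne', hq'⟩
    obtain ⟨h2, -, h3⟩ := mem_separators.1 h1
    have := card_comp_lt_of_separated hconn (hQR hq) hne'.symm hr h3
      (fun h => hrQ (h ▸ h2))
    have := hmax q hqx
    omega
  · right
    rw [← hE, erase_eq_of_notMem hqx]

/-- A separator of `x` is the last one, or it separates the last one from the root. -/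
theorem lastSeparator_eq_or_separated (hr : I.r ∈ R) (hQR : Q ⊆ R) (hrQ : I.r ∉ Q) {q x : V}
    (hx : x ∈ R) (hqx : q ∈ I.separators R Q x) :
    I.lastSeparator R (I.separators R Q x) = some q ∨
      ∃ q' ∈ I.separators R Q x, q ∈ I.separators R Q q' := by
  obtain ⟨q', hq', heq, hmax⟩ := I.lastSeparator_spec (R := R) ⟨q, hqx⟩
  by_cases hne : q = q'
  · exact Or.inl (hne ▸ heq)
  right
  obtain ⟨h1, h2, h3⟩ := mem_separators.1 hqx
  obtain ⟨h1', h2', h3'⟩ := mem_separators.1 hq'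
  have hrq : I.r ≠ q := fun h => hrQ (h ▸ h1)
  have hrq' : I.r ≠ q' := fun h => hrQ (h ▸ h1')
  refine ⟨q', hq', mem_separators.2 ⟨h1, hne, ?_⟩⟩
  rcases not_separated_both hconn hx h3 h3' hr hrq with h | h
  · have := hmax q hqx
    have := card_comp_lt_of_separated hconn (hQR h1) hne hr h hrq'
    omega
  · exact h

/-- Unless `q` is the last separator of `x`, it separates an element of `Q` from the root;
descending through last separators, with shrinking root components, ends at a child of `q`. -/
theorem exists_lastSeparator_eq (hr : I.r ∈ R) (hQR : Q ⊆ R) (hrQ : I.r ∉ Q) {q x : V}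
    (hx : x ∈ R) (hqx : q ∈ I.separators R Q x) :
    I.lastSeparator R (I.separators R Q x) = some q ∨
      ∃ q' ∈ Q, I.lastSeparator R (I.separators R Q q') = some q := by
  have key : ∀ n, ∀ q' ∈ Q, #(I.comp (R.erase q') I.r) ≤ n → q ∈ I.separators R Q q' →
      ∃ q' ∈ Q, I.lastSeparator R (I.separators R Q q') = some q := by
    intro n
    induction n with
    | zero =>
      intro q' hq' h0 _
      have hmem : I.r ∈ I.comp (R.erase q') I.r :=
        mem_comp_self (mem_erase.2 ⟨fun h => hrQ (h ▸ hq'), hr⟩)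
      have := card_pos.2 ⟨_, hmem⟩
      omega
    | succ n ih =>
      intro q' hq' hn hqq'
      rcases lastSeparator_eq_or_separated hconn hr hQR hrQ (hQR hq') hqq' with h | ⟨d, hd, hqd⟩
      · exact ⟨q', hq', h⟩
      · obtain ⟨h1, h2, h3⟩ := mem_separators.1 hd
        have := card_comp_lt_of_separated hconn (hQR hq') h2.symm hr h3
          (fun h => hrQ (h ▸ h1))
        exact ih d h1 (by omega) hqd
  rcases lastSeparator_eq_or_separated hconn hr hQR hrQ hx hqx with h | ⟨d, hd, hqd⟩
  · exact Or.inl h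
  · exact Or.inr (key _ d (mem_separators.1 hd).1 le_rfl hqd)

/-- If every vertex of `Q` separates a moat from the root, there are at most three times as many
incidences between `Q` and the moats as there are moats. -/
theorem sum_card_nbrs_le (hG : IsPlanar I.G) (hr : I.r ∈ R) (hQR : Q ⊆ R) (hrQ : I.r ∉ Q)
    {A : Finset (Finset V)} (hAR : ∀ S ∈ A, S ⊆ R)
    (hA : ∀ S ∈ A, ∃ ρ ∈ S, ∀ x ∈ S, x ∈ I.comp S ρ)
    (hdisj : ∀ S ∈ A, ∀ T ∈ A, ∀ x ∈ S, x ∈ T → S = T) (hAQ : ∀ S ∈ A, ∀ q ∈ Q, q ∉ S)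
    (hsep : ∀ q ∈ Q, ∃ S ∈ A, ∃ x ∈ S, x ∉ I.comp (R.erase q) I.r) :
    ∑ S ∈ A, #(Q ∩ I.nbrs S) ≤ 3 * #A := by
  classical
  have : Nonempty V := ⟨I.r⟩
  choose! ρ hρ hρS using hA
  set par : V → Option V := fun x => I.lastSeparator R (I.separators R Q x) with hpar
  -- A moat is connected and avoids `Q`, so no `q` splits it and it has a well-defined parent.
  have hsepS : ∀ S ∈ A, ∀ x ∈ S, I.separators R Q x = I.separators R Q (ρ S) := by
    intro S hS x hx
    ext q
    simp only [mem_separators]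
    refine and_congr_right fun hq => ?_
    have hqS := hAQ S hS q hq
    have hx' : x ∈ I.comp (R.erase q) (ρ S) := comp_mono
      (fun y hy => mem_erase.2 ⟨ne_of_mem_of_not_mem hy hqS, hAR S hS hy⟩) _ (hρS S hS x hx)
    have h1 : q ≠ x := fun h => hqS (h ▸ hx)
    have h2 : q ≠ ρ S := fun h => hqS (h ▸ hρ S hS)
    simp only [ne_eq, h1, h2, not_false_eq_true, true_and]
    exact not_congr ⟨fun h => mem_comp_trans h (mem_comp_symm hx'),
      fun h => mem_comp_trans h hx'⟩
  have hadj : ∀ S ∈ A, ∀ q ∈ Q, q ∈ I.nbrs S → par (ρ S) = some q ∨ par (ρ S) = par q := by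
    intro S hS q hq hqS
    obtain ⟨-, x, hx, hadj⟩ := mem_nbrs.1 hqS
    have := lastSeparator_of_adj hconn hr hQR hrQ hq (hAR S hS hx)
      (fun h => hAQ S hS x h hx) hadj
    rwa [hsepS S hS x hx] at this
  have hchild : ∀ q ∈ Q, (∃ S ∈ A, par (ρ S) = some q) ∨ ∃ q' ∈ Q, par q' = some q := by
    intro q hq
    obtain ⟨S, hS, x, hx, hxq⟩ := hsep q hq
    have hqx : q ∈ I.separators R Q x :=
      mem_separators.2 ⟨hq, fun h => hAQ S hS q hq (h ▸ hx), hxq⟩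
    rcases exists_lastSeparator_eq hconn hr hQR hrQ (hAR S hS hx) hqx with h | h
    · rw [hsepS S hS x hx] at h
      exact Or.inl ⟨S, hS, h⟩
    · exact Or.inr h
  have hparQ : ∀ x, par x ∈ insertNone Q := by
    intro x
    rw [mem_insertNone]
    intro q hq
    exact (mem_separators.1 (mem_of_lastSeparator_eq hq)).1
  have hself : ∀ q, par q ≠ some q := by
    intro q hq
    exact (mem_separators.1 (mem_of_lastSeparator_eq hq)).2.1 rfl
  set E : Finset (Finset V × V) := {p ∈ A ×ˢ Q | p.2 ∈ I.nbrs p.1} with hE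
  have hEcard : ∑ S ∈ A, #(Q ∩ I.nbrs S) = #E := by
    rw [hE, card_filter, sum_product]
    refine sum_congr rfl fun S _ => ?_
    rw [← card_filter, ← filter_mem_eq_inter]
  have h1 : #E = ∑ d ∈ insertNone Q, #{p ∈ E | par (ρ p.1) = d} :=
    card_eq_sum_card_fiberwise fun p _ => hparQ _
  have h2 : #A = ∑ d ∈ insertNone Q, #{S ∈ A | par (ρ S) = d} :=
    card_eq_sum_card_fiberwise fun p _ => hparQ _
  have h3 : #Q = ∑ d ∈ insertNone Q, #{q ∈ Q | par q = d} :=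
    card_eq_sum_card_fiberwise fun p _ => hparQ _
  have h4 : #Q = ∑ d ∈ insertNone Q, #(d.toFinset) := by
    rw [sum_insertNone]
    simp
  -- Write `e + 2c ≤ 3a + 2b`. Each `q ∈ Q` is counted once in `c`, as a parent, and once in `b`, as
  -- a child, so on summation the terms with factor 2 cancel, leaving `#E ≤ 3 * #A`.
  have hgroup : ∀ d ∈ insertNone Q, #{p ∈ E | par (ρ p.1) = d} + 2 * #(d.toFinset) ≤
      3 * #{S ∈ A | par (ρ S) = d} + 2 * #{q ∈ Q | par q = d} := by
    intro d hd
    have hdQ : ∀ q ∈ d.toFinset, q ∈ Q := fun q hq =>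
      mem_insertNone.1 hd q (by simpa using hq)
    have hEsub : ∀ p ∈ E.filter (fun p => par (ρ p.1) = d),
        p.1 ∈ A.filter (fun S => par (ρ S) = d) ∧
          p.2 ∈ Q.filter (fun q => par q = d) ∪ d.toFinset ∧
          ∃ x ∈ p.1, I.G.Adj x p.2 := by
      intro p hp
      simp only [hE, mem_filter, mem_product] at hp
      obtain ⟨⟨⟨hpA, hpQ⟩, hpn⟩, hpd⟩ := hp
      refine ⟨mem_filter.2 ⟨hpA, hpd⟩, ?_, (mem_nbrs.1 hpn).2⟩
      rcases hadj p.1 hpA p.2 hpQ hpn with h | h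
      · refine mem_union_right _ ?_
        rw [hpd] at h
        simp [h]
      · exact mem_union_left _ (mem_filter.2 ⟨hpQ, h ▸ hpd⟩)
    have hdisj' : Disjoint (Q.filter (fun q => par q = d)) d.toFinset := by
      rw [disjoint_left]
      intro q hq hq'
      have hd' : d = some q := by simpa using hq'
      exact hself q ((mem_filter.1 hq).2.trans hd')
    have hcardU := card_union_of_disjoint hdisj'
    have hd1 : #(d.toFinset) ≤ 1 := by
      cases d <;> simp
    have hd0 : 1 ≤ #(d.toFinset) →
        1 ≤ #{S ∈ A | par (ρ S) = d} + #{q ∈ Q | par q = d} := by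
      intro h
      cases d with
      | none => simp at h
      | some q =>
        rcases hchild q (hdQ q (by simp)) with ⟨S, hS, h⟩ | ⟨q', hq', h⟩
        · have : 0 < #{S ∈ A | par (ρ S) = some q} := card_pos.2 ⟨S, mem_filter.2 ⟨hS, h⟩⟩
          omega
        · have : 0 < #{q' ∈ Q | par q' = some q} := card_pos.2 ⟨q', mem_filter.2 ⟨hq', h⟩⟩
          omega
    have hprod : #{p ∈ E | par (ρ p.1) = d} ≤
        #{S ∈ A | par (ρ S) = d} * (#{q ∈ Q | par q = d} + #(d.toFinset)) := by
      rw [← hcardU, ← card_product]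
      exact card_le_card fun p hp => mem_product.2 ⟨(hEsub p hp).1, (hEsub p hp).2.1⟩
    -- With at least three members, `e + 4 ≤ 2(a + b + c)` and `c ≤ 1` give even `e + 2c ≤ 2a + 2b`.
    by_cases hn : 3 ≤ #{S ∈ A | par (ρ S) = d} + (#{q ∈ Q | par q = d} + #(d.toFinset))
    · have hbig := hG.card_adj_pairs_add_four_le (A := A.filter (fun S => par (ρ S) = d))
        (Q := Q.filter (fun q => par q = d) ∪ d.toFinset) (r := I.r)
        (P := E.filter (fun p => par (ρ p.1) = d)) (fun S hS => ?_)
        (fun S hS T hT => hdisj S (mem_filter.1 hS).1 T (mem_filter.1 hT).1)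
        (fun S hS q hq => hAQ S (mem_filter.1 hS).1 q
          ((mem_union.1 hq).elim (fun h => (mem_filter.1 h).1) (hdQ q)))
        (fun S hS x hx => ?_) hEsub (by rw [hcardU]; exact hn)
      · rw [hcardU] at hbig
        omega
      · have hS' := (mem_filter.1 hS).1
        exact ⟨ρ S, hρ S hS', fun x hx => I.mem_comp.1 (mem_comp_symm (hρS S hS' x hx))⟩
      · obtain ⟨p, -⟩ := I.mem_comp.1 (hconn x (hAR S (mem_filter.1 hS).1 hx))
        exact ⟨p⟩
    -- For small groups `e ≤ a(b + c)` suffices, since `hd0` rules out a separator without children.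
    -- The case `a = c = e = 1`, `b = 0` is the one that needs the factor 3.
    · generalize #{S ∈ A | par (ρ S) = d} = a at *
      generalize #{q ∈ Q | par q = d} = b at *
      generalize #(d.toFinset) = c at *
      have ha : a ≤ 2 := by omega
      have hb : b ≤ 2 := by omega
      interval_cases a <;> interval_cases b <;> interval_cases c <;> omega
  have hsum := sum_le_sum hgroup
  rw [sum_add_distrib, sum_add_distrib, ← mul_sum, ← mul_sum, ← mul_sum, ← h1, ← h2, ← h3, ← h4]
    at hsum
  omega

end Separators

end NWPCST

namespace NWPCST

open Finset

/-! ### Weak duality and tight sets -/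

section Duality

set_option linter.unusedSectionVars false

variable {V : Type*} [Fintype V] [DecidableEq V] {I : NWPCST V}

theorem mem_dualSets {S : Finset V} : S ∈ I.dualSets ↔ I.r ∉ S := by
  rw [dualSets, mem_powerset]
  exact ⟨fun h hr => (mem_erase.1 (h hr)).1 rfl,
    fun h v hv => mem_erase.2 ⟨fun h' => h (h' ▸ hv), mem_univ v⟩⟩

theorem mem_dualSets_of_subset {S X : Finset V} (hX : X ∈ I.dualSets) (h : S ⊆ X) :
    S ∈ I.dualSets :=
  mem_dualSets.2 fun hr => mem_dualSets.1 hX (h hr)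

theorem filter_disjoint_dualSets {F : Finset V} (hF : I.r ∈ F) :
    {S ∈ I.dualSets | Disjoint S F} = Fᶜ.powerset := by
  ext S
  rw [mem_filter, mem_powerset, mem_dualSets, subset_compl_iff_disjoint_right]
  exact ⟨fun h => h.2, fun h => ⟨fun hr => disjoint_left.1 h hr hF, h⟩⟩

theorem sum_load_eq (y : Finset V → ℝ) (F : Finset V) :
    ∑ v ∈ F, I.load y v = ∑ S ∈ I.dualSets, y S * #(F ∩ I.nbrs S) := by
  simp only [load, sum_filter]
  rw [sum_comm]
  refine sum_congr rfl fun S _ => ?_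
  rw [← sum_filter, filter_mem_eq_inter, sum_const, nsmul_eq_mul, mul_comm]

/-- Otherwise `F \ S` would be closed under adjacency in `F` and, containing the root, be all of
`F`. -/
theorem IsSolution.exists_mem_nbrs {F S : Finset V} (hF : I.IsSolution F) (hS : I.r ∉ S)
    (h : ¬ Disjoint S F) : (F ∩ I.nbrs S).Nonempty := by
  by_contra hne
  rw [not_nonempty_iff_eq_empty] at hne
  obtain ⟨x, hxS, hxF⟩ := not_disjoint_iff.1 h
  have := comp_subset_of_closed (I := I) (F := F) (v := I.r) (X := F \ S)
    (mem_sdiff.2 ⟨hF.1, hS⟩) ?_ (hF.mem_comp hxF)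
  · exact (mem_sdiff.1 this).2 hxS
  · intro a ha b hb hadj
    refine mem_sdiff.2 ⟨hb, fun hbS => ?_⟩
    have : a ∈ F ∩ I.nbrs S :=
      mem_inter.2 ⟨(mem_sdiff.1 ha).1, mem_nbrs.2 ⟨(mem_sdiff.1 ha).2, b, hbS, hadj.symm⟩⟩
    simp [hne] at this

/-- Weak duality. -/
theorem IsDualFeasible.sum_le_cost {y : Finset V → ℝ} (hy : I.IsDualFeasible y) {F : Finset V}
    (hF : I.IsSolution F) : ∑ S ∈ I.dualSets, y S ≤ I.cost F := by
  rw [← sum_filter_add_sum_filter_not I.dualSets (fun S => Disjoint S F), cost, add_comm]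
  refine add_le_add ?_ ?_
  · calc ∑ S ∈ I.dualSets with ¬ Disjoint S F, y S
        ≤ ∑ S ∈ I.dualSets with ¬ Disjoint S F, y S * #(F ∩ I.nbrs S) := by
          refine sum_le_sum fun S hS => ?_
          rw [mem_filter] at hS
          have h1 : (1 : ℝ) ≤ #(F ∩ I.nbrs S) := by
            exact_mod_cast card_pos.2 (hF.exists_mem_nbrs (mem_dualSets.1 hS.1) hS.2)
          exact le_mul_of_one_le_right (hy.nonneg S hS.1) h1
      _ ≤ ∑ S ∈ I.dualSets, y S * #(F ∩ I.nbrs S) :=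
          sum_le_sum_of_subset_of_nonneg (filter_subset _ _) fun S hS _ =>
            mul_nonneg (hy.nonneg S hS) (Nat.cast_nonneg _)
      _ = ∑ v ∈ F, I.load y v := (sum_load_eq y F).symm
      _ ≤ I.weight F := sum_le_sum fun v _ => hy.vertex v
  · rw [filter_disjoint_dualSets hF.1]
    exact hy.set _ (mem_dualSets.2 fun h => (mem_compl.1 h) hF.1)

theorem IsDualFeasible.sum_le_opt {y : Finset V → ℝ} (hy : I.IsDualFeasible y) :
    ∑ S ∈ I.dualSets, y S ≤ I.opt := by
  rw [opt]
  exact le_inf' _ _ fun _ hF => hy.sum_le_cost (by simpa using hF)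

theorem penalty_union_add_inter (X Y : Finset V) :
    I.penalty (X ∪ Y) + I.penalty (X ∩ Y) = I.penalty X + I.penalty Y :=
  sum_union_inter

/-- The union of two tight sets is tight. -/
theorem IsDualFeasible.tight_union {y : Finset V → ℝ} (hy : I.IsDualFeasible y) {X Y : Finset V}
    (hX : I.r ∉ X) (hY : I.r ∉ Y) (htX : I.penalty X ≤ ∑ S ∈ X.powerset, y S)
    (htY : I.penalty Y ≤ ∑ S ∈ Y.powerset, y S) :
    I.penalty (X ∪ Y) ≤ ∑ S ∈ (X ∪ Y).powerset, y S := by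
  -- Penalties are modular and `∑ S ∈ X.powerset, y S` is supermodular in `X`; feasibility of the
  -- intersection transfers tightness to the union.
  have h1 := I.penalty_union_add_inter X Y
  have h2 := hy.set (X ∩ Y) (mem_dualSets.2 fun h => hX (mem_inter.1 h).1)
  have h3 : ∑ S ∈ X.powerset ∪ Y.powerset, y S + ∑ S ∈ X.powerset ∩ Y.powerset, y S =
    ∑ S ∈ X.powerset, y S + ∑ S ∈ Y.powerset, y S := sum_union_inter
  have h5 : X.powerset ∩ Y.powerset = (X ∩ Y).powerset := by
    ext S
    rw [mem_powerset, subset_inter_iff, mem_inter, mem_powerset, mem_powerset]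
  rw [h5] at h3
  have h4 : ∑ S ∈ X.powerset ∪ Y.powerset, y S ≤ ∑ S ∈ (X ∪ Y).powerset, y S := by
    refine sum_le_sum_of_subset_of_nonneg (union_subset (powerset_mono.2 subset_union_left)
      (powerset_mono.2 subset_union_right)) fun S hS _ => hy.nonneg S (mem_dualSets.2 fun h => ?_)
    exact (mem_union.1 (mem_powerset.1 hS h)).elim hX hY
  linarith

/-- A set is tight if its terminals are covered by tight subsets. -/
theorem IsDualFeasible.tight_of_cover {y : Finset V → ℝ} (hy : I.IsDualFeasible y) {Z : Finset V}
    (hZ : I.r ∉ Z) (hcov : ∀ u ∈ Z, I.IsTerminal u →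
      ∃ X, u ∈ X ∧ X ⊆ Z ∧ I.penalty X ≤ ∑ S ∈ X.powerset, y S) :
    I.penalty Z ≤ ∑ S ∈ Z.powerset, y S := by
  have key : ∀ T ⊆ Z, ∃ U ⊆ Z, (∀ u ∈ T, I.IsTerminal u → u ∈ U) ∧
      I.penalty U ≤ ∑ S ∈ U.powerset, y S := by
    intro T
    induction T using Finset.induction_on with
    | empty =>
      refine fun _ => ⟨∅, empty_subset _, by simp, ?_⟩
      simpa [penalty] using hy.nonneg ∅ (mem_dualSets.2 (by simp))
    | insert a T _ ih =>
      intro hT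
      obtain ⟨U, hUZ, hU, htU⟩ := ih ((subset_insert _ _).trans hT)
      by_cases ha : I.IsTerminal a
      · obtain ⟨X, haX, hXZ, htX⟩ := hcov a (hT (mem_insert_self _ _)) ha
        refine ⟨X ∪ U, union_subset hXZ hUZ, fun u hu hut => ?_,
          hy.tight_union (fun h => hZ (hXZ h)) (fun h => hZ (hUZ h)) htX htU⟩
        rcases mem_insert.1 hu with rfl | hu
        · exact mem_union_left _ haX
        · exact mem_union_right _ (hU u hu hut)
      · refine ⟨U, hUZ, fun u hu hut => ?_, htU⟩
        rcases mem_insert.1 hu with rfl | hu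
        · exact absurd hut ha
        · exact hU u hu hut
  obtain ⟨U, hUZ, hU, htU⟩ := key Z subset_rfl
  have h1 : I.penalty U = I.penalty Z := by
    refine sum_subset hUZ fun u hu hu' => ?_
    have : ¬ I.IsTerminal u := fun h => hu' (hU u hu h)
    exact le_antisymm (not_lt.1 this) (I.π_nonneg u)
  rw [← h1]
  exact htU.trans (sum_le_sum_of_subset_of_nonneg (powerset_mono.2 hUZ) fun S hS _ =>
    hy.nonneg S (mem_dualSets.2 fun h => hZ (mem_powerset.1 hS h)))

end Duality

/-! ### The growth phase -/

section Growth

set_option linter.unusedSectionVars false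

variable {V : Type*} [Fintype V] [DecidableEq V] {I : NWPCST V}

theorem State.le_grow (s : State V) {ε : ℝ} (hε : 0 ≤ ε) (S : Finset V) : s.y S ≤ s.grow ε S := by
  rw [State.grow]
  split_ifs <;> linarith

theorem State.sum_grow_mul (s : State V) (ε : ℝ) (D : Finset (Finset V)) (g : Finset V → ℝ) :
    ∑ S ∈ D, s.grow ε S * g S =
      ∑ S ∈ D, s.y S * g S + ε * ∑ S ∈ s.active with S ∈ D, g S := by
  have h : ∀ S, s.grow ε S * g S = s.y S * g S + if S ∈ s.active then ε * g S else 0 := by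
    intro S
    rw [State.grow]
    split_ifs <;> ring
  simp only [h, sum_add_distrib]
  rw [← sum_filter, mul_sum]
  congr 2
  ext S
  simp [and_comm]

theorem State.sum_grow (s : State V) (ε : ℝ) (D : Finset (Finset V)) :
    ∑ S ∈ D, s.grow ε S = ∑ S ∈ D, s.y S + ε * #{S ∈ s.active | S ∈ D} := by
  simpa using s.sum_grow_mul ε D (fun _ => 1)

theorem mem_active_buy {s : State V} {ε : ℝ} {v : V} {S : Finset V} :
    S ∈ (I.buy s ε v).active ↔ (S ∈ s.active ∧ v ∉ I.nbrs S) ∨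
      (I.r ∉ I.comp (insert v s.bought) v ∧ S = I.comp (insert v s.bought) v) := by
  simp only [buy, mem_union, mem_filter]
  split_ifs with h <;> simp [h]

/-- The invariants of the growth phase. -/
structure GrowthInv (I : NWPCST V) (s : State V) : Prop where
  feasible : I.IsDualFeasible s.y
  root_mem : I.r ∈ s.bought
  terminal_mem : ∀ v, I.IsTerminal v → v ∈ s.bought
  purchase_ne_root : ∀ p ∈ s.purchases, p.1 ≠ I.r
  purchase_lt : ∀ p ∈ s.purchases, p.2 < s.time
  sorted : s.purchases.Pairwise fun p q => q.2 < p.2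
  active_moat : ∀ S ∈ s.active, I.r ∉ S ∧ ∃ x ∈ s.bought, S = I.comp s.bought x
  support : ∀ S, s.y S ≠ 0 → ∃ x ∈ s.bought, S ⊆ I.comp s.bought x
  unmarked : ∀ u, I.IsTerminal u → s.mark u = ⊤ →
    I.r ∈ I.comp s.bought u ∨ I.comp s.bought u ∈ s.active
  -- `X` is the moat in which `u` was marked, frozen at that time.
  marked : ∀ u, s.mark u ≠ ⊤ → ∃ X, u ∈ X ∧ X ⊆ s.bought ∧ I.r ∉ X ∧ (∀ x ∈ X, x ∈ I.comp X u) ∧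
    I.penalty X ≤ ∑ S ∈ X.powerset, s.y S ∧ ∀ p ∈ s.purchases, s.mark u ≤ p.2 → p.1 ∉ X
  mark_lt : ∀ u, s.mark u ≠ ⊤ → s.mark u < s.time
  tight : ∀ v ∈ s.bought, I.w v ≤ I.load s.y v

theorem GrowthInv.init (I : NWPCST V) : I.GrowthInv I.init where
  feasible :=
    { nonneg := fun _ _ => le_rfl
      vertex := fun v => by simpa [load, NWPCST.init] using I.w_nonneg v
      set := fun X _ => by simpa [NWPCST.init, penalty] using sum_nonneg fun v _ => I.π_nonneg v }
  root_mem := by simp [NWPCST.init]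
  terminal_mem v hv := by simp [NWPCST.init, hv]
  purchase_ne_root p hp := by simp [NWPCST.init] at hp
  purchase_lt p hp := by simp [NWPCST.init] at hp
  sorted := List.Pairwise.nil
  active_moat S hS := by
    simp only [NWPCST.init, mem_filter, mem_image] at hS
    obtain ⟨⟨x, hx, rfl⟩, hr⟩ := hS
    exact ⟨hr, x, by simpa [NWPCST.init] using hx, rfl⟩
  support S hS := by simp [NWPCST.init] at hS
  unmarked u hu _ := by
    by_cases h : I.r ∈ I.comp I.init.bought u
    · exact Or.inl h
    · refine Or.inr ?_
      simp only [NWPCST.init] at h ⊢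
      exact mem_filter.2 ⟨mem_image.2 ⟨u, by simp [hu], rfl⟩, h⟩
  marked u hu := by simp [NWPCST.init] at hu
  mark_lt u hu := by simp [NWPCST.init] at hu
  tight v hv := by
    have h0 : I.w v = 0 := by
      have : v = I.r ∨ I.IsTerminal v := by simpa [NWPCST.init] using hv
      rcases this with rfl | h
      · exact I.w_root
      · exact (I.w_or_π v).resolve_right (ne_of_gt h)
    simp [h0, load, NWPCST.init]

theorem comp_subset_comp_insert {F S : Finset V} {v : V}
    (h : ∃ x ∈ F, S ⊆ I.comp F x) : ∃ x ∈ insert v F, S ⊆ I.comp (insert v F) x := by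
  obtain ⟨x, hx, hS⟩ := h
  exact ⟨x, mem_insert_of_mem hx, hS.trans (comp_mono (subset_insert _ _) x)⟩

theorem GrowthInv.support_grow {s : State V} (h : I.GrowthInv s) (ε : ℝ) (S : Finset V)
    (hS : s.grow ε S ≠ 0) : ∃ x ∈ s.bought, S ⊆ I.comp s.bought x := by
  by_cases hact : S ∈ s.active
  · obtain ⟨-, x, hx, hSx⟩ := h.active_moat S hact
    exact ⟨x, hx, hSx.subset⟩
  · rw [State.grow, if_neg hact] at hS
    exact h.support S hS

/-- Dual values only grow, so tightness persists. Moats not adjacent to `v` remain components, and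
`v` lies in no recorded tight moat because those were bought before. -/
theorem GrowthInv.buy {s : State V} (h : I.GrowthInv s) {ε : ℝ} {v : V} (hε : 0 ≤ ε)
    (hfeas : I.IsDualFeasible (s.grow ε)) (hv : v ∉ s.bought)
    (htight : I.load (s.grow ε) v = I.w v) : I.GrowthInv (I.buy s ε v) where
  feasible := hfeas
  root_mem := mem_insert_of_mem h.root_mem
  terminal_mem u hu := mem_insert_of_mem (h.terminal_mem u hu)
  purchase_ne_root p hp := by
    rcases List.mem_cons.1 hp with rfl | hp
    · exact fun h' : v = I.r => hv (h'.symm ▸ h.root_mem)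
    · exact h.purchase_ne_root p hp
  purchase_lt p hp := by
    rcases List.mem_cons.1 hp with rfl | hp
    · exact Nat.lt_succ_self _
    · exact (h.purchase_lt p hp).trans (Nat.lt_succ_self _)
  sorted := List.pairwise_cons.2 ⟨fun p hp => h.purchase_lt p hp, h.sorted⟩
  active_moat S hS := by
    rcases mem_active_buy.1 hS with ⟨hS, hvS⟩ | ⟨hr, rfl⟩
    · obtain ⟨hr, x, hx, rfl⟩ := h.active_moat S hS
      exact ⟨hr, x, mem_insert_of_mem hx, (comp_insert_of_notMem_nbrs hx hv hvS).symm⟩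
    · exact ⟨hr, v, mem_insert_self _ _, rfl⟩
  support S hS := comp_subset_comp_insert (h.support_grow ε S hS)
  unmarked u hu hmark := by
    have hu' := h.terminal_mem u hu
    change I.r ∈ I.comp (insert v s.bought) u ∨ I.comp (insert v s.bought) u ∈ _
    by_cases huv : v ∈ I.comp (insert v s.bought) u
    · rw [← comp_eq_of_mem huv]
      by_cases hr : I.r ∈ I.comp (insert v s.bought) v
      · exact Or.inl hr
      · exact Or.inr (mem_active_buy.2 (Or.inr ⟨hr, rfl⟩))
    · have hn : v ∉ I.nbrs (I.comp s.bought u) := fun hn => by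
        obtain ⟨-, x, hx, hadj⟩ := mem_nbrs.1 hn
        exact huv (mem_comp_of_adj (comp_mono (subset_insert _ _) _ hx) hadj (mem_insert_self _ _))
      rw [comp_insert_of_notMem_nbrs hu' hv hn]
      exact (h.unmarked u hu hmark).imp_right fun h' => mem_active_buy.2 (Or.inl ⟨h', hn⟩)
  marked u hu := by
    obtain ⟨X, huX, hXb, hr, hconn, ht, hp⟩ := h.marked u hu
    refine ⟨X, huX, hXb.trans (subset_insert _ _), hr, hconn,
      ht.trans (sum_le_sum fun S _ => s.le_grow hε S), fun p hp' hle => ?_⟩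
    rcases List.mem_cons.1 hp' with rfl | hp'
    · exact fun hvX => hv (hXb hvX)
    · exact hp p hp' hle
  mark_lt u hu := (h.mark_lt u hu).trans (by exact_mod_cast Nat.lt_succ_self _)
  tight u hu := by
    rcases mem_insert.1 hu with rfl | hu
    · exact htight.ge
    · exact (h.tight u hu).trans (sum_le_sum fun S _ => s.le_grow hε S)

theorem GrowthInv.deactivate {s : State V} (h : I.GrowthInv s) {ε : ℝ} {X : Finset V} (hε : 0 ≤ ε)
    (hfeas : I.IsDualFeasible (s.grow ε)) (hX : X ∈ s.active)
    (htight : ∑ S ∈ X.powerset, s.grow ε S = I.penalty X) : I.GrowthInv (I.deactivate s ε X) where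
  feasible := hfeas
  root_mem := h.root_mem
  terminal_mem := h.terminal_mem
  purchase_ne_root := h.purchase_ne_root
  purchase_lt p hp := (h.purchase_lt p hp).trans (Nat.lt_succ_self _)
  sorted := h.sorted
  active_moat S hS := h.active_moat S (mem_of_mem_erase hS)
  support S hS := h.support_grow ε S hS
  unmarked u hu hmark := by
    simp only [NWPCST.deactivate] at hmark ⊢
    split_ifs at hmark with hc
    · exact absurd hmark (ENat.natCast_ne_top _)
    · refine (h.unmarked u hu hmark).imp_right fun h' => mem_erase.2 ⟨fun hne => hc ⟨?_, hu, hmark⟩, h'⟩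
      rw [← hne]
      exact mem_comp_self (h.terminal_mem u hu)
  marked u hu := by
    simp only [NWPCST.deactivate] at hu ⊢
    split_ifs at hu ⊢ with hc
    · obtain ⟨hr, x, hx, rfl⟩ := h.active_moat X hX
      refine ⟨_, hc.1, comp_subset _ _, hr, fun z hz => ?_, htight.ge, fun p hp hle => ?_⟩
      · rw [← comp_eq_of_mem hc.1] at hz ⊢
        exact mem_comp_comp hz
      · have := h.purchase_lt p hp
        have : s.time ≤ p.2 := by exact_mod_cast hle
        omega
    · obtain ⟨Y, huY, hYb, hr, hconn, ht, hp⟩ := h.marked u hu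
      exact ⟨Y, huY, hYb, hr, hconn, ht.trans (sum_le_sum fun S _ => s.le_grow hε S), hp⟩
  mark_lt u hu := by
    simp only [NWPCST.deactivate] at hu ⊢
    split_ifs at hu ⊢ with hc
    · exact_mod_cast Nat.lt_succ_self _
    · exact (h.mark_lt u hu).trans (by exact_mod_cast Nat.lt_succ_self _)
  tight u hu := (h.tight u hu).trans (sum_le_sum fun S _ => s.le_grow hε S)

theorem GrowthInv.step {s s' : State V} (h : I.GrowthInv s) (hs : I.Step s s') : I.GrowthInv s' := by
  cases hs with
  | buy ε v hactive hε hfeas hv htight hadj => exact h.buy hε hfeas hv htight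
  | deactivate ε X hε hfeas hX htight => exact h.deactivate hε hfeas hX htight

theorem Reachable.growthInv {s : State V} (hs : I.Reachable s) : I.GrowthInv s := by
  induction hs with
  | refl => exact GrowthInv.init I
  | tail _ hstep ih => exact ih.step hstep

theorem Step.exists_grow {s s' : State V} (hs : I.Step s s') :
    ∃ ε, 0 ≤ ε ∧ I.IsDualFeasible (s.grow ε) ∧ s'.y = s.grow ε := by
  cases hs with
  | buy ε v hactive hε hfeas hv htight hadj => exact ⟨ε, hε, hfeas, rfl⟩
  | deactivate ε X hε hfeas hX htight => exact ⟨ε, hε, hfeas, rfl⟩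

/-! ### Termination -/

/-- A purchase may add one active moat, so an unbought vertex has to weigh 2. -/
theorem Step.potential_lt {s s' : State V} (hs : I.Step s s') :
    2 * #s'.boughtᶜ + #s'.active < 2 * #s.boughtᶜ + #s.active := by
  cases hs with
  | buy ε v hactive hε hfeas hv htight hadj =>
    have h1 : #(I.buy s ε v).active ≤ #s.active + 1 := by
      refine (card_le_card (t := insert (I.comp (insert v s.bought) v) s.active) ?_).trans
        (card_insert_le _ _)
      intro S hS
      rcases mem_active_buy.1 hS with h | h
      · exact mem_insert_of_mem h.1
      · exact mem_insert.2 (Or.inl h.2)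
    have h2 : #(I.buy s ε v).boughtᶜ + 1 = #s.boughtᶜ := by
      change #(insert v s.bought)ᶜ + 1 = _
      rw [compl_insert]
      exact card_erase_add_one (mem_compl.2 hv)
    omega
  | deactivate ε X hε hfeas hX htight =>
    have h1 : #(I.deactivate s ε X).active + 1 = #s.active := card_erase_add_one hX
    have h2 : #(I.deactivate s ε X).boughtᶜ = #s.boughtᶜ := rfl
    omega

theorem not_exists_infinite_run (I : NWPCST V) :
    ¬ ∃ run : ℕ → State V, run 0 = I.init ∧ ∀ n, I.Step (run n) (run (n + 1)) := by
  rintro ⟨run, -, hrun⟩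
  have h : ∀ n, 2 * #(run n).boughtᶜ + #(run n).active + n ≤
      2 * #(run 0).boughtᶜ + #(run 0).active := by
    intro n
    induction n with
    | zero => simp
    | succ n ih =>
      have := (hrun n).potential_lt
      omega
  have := h (2 * #(run 0).boughtᶜ + #(run 0).active + 1)
  omega

/-! ### Progress -/

theorem GrowthInv.eq_of_mem_active {s : State V} (h : I.GrowthInv s) {S T : Finset V} {x : V}
    (hS : S ∈ s.active) (hT : T ∈ s.active) (hxS : x ∈ S) (hxT : x ∈ T) : S = T := by
  obtain ⟨-, a, -, rfl⟩ := h.active_moat S hS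
  obtain ⟨-, b, -, rfl⟩ := h.active_moat T hT
  rw [← comp_eq_of_mem hxS, comp_eq_of_mem hxT]

theorem GrowthInv.nonempty_of_mem_active {s : State V} (h : I.GrowthInv s) {S : Finset V}
    (hS : S ∈ s.active) : S.Nonempty := by
  obtain ⟨-, a, ha, rfl⟩ := h.active_moat S hS
  exact ⟨a, mem_comp_self ha⟩

theorem GrowthInv.mem_dualSets {s : State V} (h : I.GrowthInv s) {S : Finset V}
    (hS : S ∈ s.active) : S ∈ I.dualSets :=
  NWPCST.mem_dualSets.2 (h.active_moat S hS).1

theorem GrowthInv.load_grow {s : State V} (h : I.GrowthInv s) (ε : ℝ) (v : V) :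
    I.load (s.grow ε) v = I.load s.y v + ε * #{S ∈ s.active | v ∈ I.nbrs S} := by
  rw [load, load, State.sum_grow]
  congr 4
  ext S
  simp only [mem_filter]
  exact ⟨fun h' => ⟨h'.1, h'.2.2⟩, fun h' => ⟨h'.1, h.mem_dualSets h'.1, h'.2⟩⟩

theorem GrowthInv.sum_powerset_grow {s : State V} (h : I.GrowthInv s) (ε : ℝ) {X : Finset V}
    (hX : X ∈ s.active) :
    ∑ S ∈ X.powerset, s.grow ε S = ∑ S ∈ X.powerset, s.y S + ε := by
  rw [State.sum_grow]
  have : {S ∈ s.active | S ∈ X.powerset} = {X} := by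
    ext S
    rw [mem_filter, mem_powerset, mem_singleton]
    refine ⟨fun h' => ?_, by rintro rfl; exact ⟨hX, subset_rfl⟩⟩
    obtain ⟨x, hx⟩ := h.nonempty_of_mem_active h'.1
    exact h.eq_of_mem_active h'.1 hX hx (h'.2 hx)
  rw [this]
  simp

/-- It suffices to check the dual constraints of the vertices and of the active moats. -/
theorem GrowthInv.isDualFeasible_grow {s : State V} (h : I.GrowthInv s) {ε : ℝ} (hε : 0 ≤ ε)
    (hvertex : ∀ v, I.load (s.grow ε) v ≤ I.w v)
    (hmoat : ∀ X ∈ s.active, ∑ S ∈ X.powerset, s.grow ε S ≤ I.penalty X) :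
    I.IsDualFeasible (s.grow ε) where
  nonneg S hS := (h.feasible.nonneg S hS).trans (s.le_grow hε S)
  vertex := hvertex
  set X hX := by
    have hnn : ∀ S ⊆ X, 0 ≤ s.y S := fun S hS =>
      h.feasible.nonneg S (mem_dualSets_of_subset hX hS)
    set C : Finset (Finset V) := {S ∈ s.active | S ⊆ X} with hC
    have hCa : ∀ S ∈ C, S ∈ s.active := fun S hS => (mem_filter.1 hS).1
    have hCX : ∀ S ∈ C, S ⊆ X := fun S hS => (mem_filter.1 hS).2
    have hUX : C.biUnion id ⊆ X := biUnion_subset.2 hCX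
    -- A set in the support of `y` lies in one component of the bought vertices. If it meets an
    -- active moat contained in `X`, it lies inside that moat; otherwise it lies in the rest of `X`,
    -- which does not grow.
    have hy : ∑ S ∈ X.powerset, s.y S ≤
        ∑ T ∈ C, ∑ S ∈ T.powerset, s.y S + ∑ S ∈ (X \ C.biUnion id).powerset, s.y S := by
      have hsub : ∀ T ⊆ X, ∑ S ∈ T.powerset, s.y S =
          ∑ S ∈ X.powerset, if S ⊆ T then s.y S else 0 := by
        intro T hT
        rw [← sum_filter]
        congr 1
        ext S
        simp only [mem_powerset, mem_filter]
        exact ⟨fun h' => ⟨h'.trans hT, h'⟩, fun h' => h'.2⟩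
      rw [hsub _ sdiff_subset, sum_congr rfl fun T hT => hsub T (hCX T hT), sum_comm,
        ← sum_add_distrib]
      refine sum_le_sum fun S hS => ?_
      rw [mem_powerset] at hS
      have h0 : ∀ T : Finset V, 0 ≤ if S ⊆ T then s.y S else 0 := fun T => by
        split_ifs
        · exact hnn S hS
        · exact le_rfl
      by_cases hS0 : s.y S = 0
      · simp [hS0]
      by_cases hd : S ⊆ X \ C.biUnion id
      · rw [if_pos hd]
        exact le_add_of_nonneg_left (sum_nonneg fun T _ => h0 T)
      · obtain ⟨a, haS, ha⟩ := not_subset.1 hd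
        have haU : a ∈ C.biUnion id := by
          by_contra h'
          exact ha (mem_sdiff.2 ⟨hS haS, h'⟩)
        obtain ⟨T, hT, haT⟩ := mem_biUnion.1 haU
        have hST : S ⊆ T := by
          obtain ⟨x, -, hx⟩ := h.support S hS0
          obtain ⟨-, z, -, hz⟩ := h.active_moat T (hCa T hT)
          have haz : a ∈ I.comp s.bought z := hz ▸ haT
          rwa [hz, ← comp_eq_of_mem haz, comp_eq_of_mem (hx haS)]
        refine le_add_of_le_of_nonneg ?_ (h0 _)
        refine le_trans ?_ (single_le_sum (fun T _ => h0 T) hT)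
        rw [if_pos hST]
    have hpen : I.penalty X = ∑ T ∈ C, I.penalty T + I.penalty (X \ C.biUnion id) := by
      have h1 : ∑ T ∈ C, I.penalty T = I.penalty (C.biUnion id) := by
        refine (sum_biUnion fun S hS T hT hne => disjoint_left.2 fun x hxS hxT => hne ?_).symm
        exact h.eq_of_mem_active (hCa S hS) (hCa T hT) hxS hxT
      rw [h1, add_comm]
      exact (sum_sdiff hUX).symm
    have hgrow : ∑ S ∈ X.powerset, s.grow ε S = ∑ S ∈ X.powerset, s.y S + ∑ T ∈ C, ε := by
      rw [State.sum_grow, sum_const, nsmul_eq_mul, mul_comm ε]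
      simp only [mem_powerset, hC]
    have hmo : ∑ T ∈ C, ∑ S ∈ T.powerset, s.y S + ∑ T ∈ C, ε ≤ ∑ T ∈ C, I.penalty T := by
      rw [← sum_add_distrib]
      refine sum_le_sum fun T hT => ?_
      rw [← h.sum_powerset_grow ε (hCa T hT)]
      exact hmoat T (hCa T hT)
    have hrest := h.feasible.set (X \ C.biUnion id) (mem_dualSets_of_subset hX sdiff_subset)
    linarith

theorem GrowthInv.exists_step {s : State V} (h : I.GrowthInv s) (hs : s.active.Nonempty) :
    ∃ s', I.Step s s' := by
  classical
  let N : Finset V := {v | ∃ S ∈ s.active, v ∈ I.nbrs S}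
  let k : V → ℕ := fun v => #{S ∈ s.active | v ∈ I.nbrs S}
  -- The growth at which each constraint becomes tight: a vertex load grows at rate `k v`, a moat
  -- constraint at rate 1. The smallest value is the next event.
  let b : V ⊕ Finset V → ℝ := Sum.elim (fun v => (I.w v - I.load s.y v) / k v)
    (fun X => I.penalty X - ∑ S ∈ X.powerset, s.y S)
  have hk : ∀ v ∈ N, (0 : ℝ) < k v := by
    intro v hv
    obtain ⟨S, hS, hvS⟩ := (mem_filter.1 hv).2
    exact_mod_cast card_pos.2 ⟨S, mem_filter.2 ⟨hS, hvS⟩⟩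
  obtain ⟨c, hc, hmin⟩ := (N.disjSum s.active).exists_min_image b
    (by obtain ⟨S, hS⟩ := hs; exact ⟨_, inr_mem_disjSum.2 hS⟩)
  have hε : 0 ≤ b c := by
    rcases mem_disjSum.1 hc with ⟨v, hv, rfl⟩ | ⟨X, hX, rfl⟩
    · exact div_nonneg (sub_nonneg.2 (h.feasible.vertex v)) (hk v hv).le
    · exact sub_nonneg.2 (h.feasible.set X (h.mem_dualSets hX))
  have hfeas : I.IsDualFeasible (s.grow (b c)) := by
    refine h.isDualFeasible_grow hε (fun v => ?_) fun X hX => ?_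
    · rw [h.load_grow]
      by_cases hv : v ∈ N
      · have h1 : b c ≤ (I.w v - I.load s.y v) / k v := hmin _ (inl_mem_disjSum.2 hv)
        rw [le_div_iff₀ (hk v hv)] at h1
        change _ + b c * (k v : ℝ) ≤ _
        linarith
      · have h0 : {S ∈ s.active | v ∈ I.nbrs S} = ∅ := by
          refine filter_eq_empty_iff.2 fun S hS hvS => hv ?_
          exact mem_filter.2 ⟨mem_univ v, S, hS, hvS⟩
        rw [h0]
        simpa using h.feasible.vertex v
    · rw [h.sum_powerset_grow _ hX]
      have h1 : b c ≤ I.penalty X - ∑ S ∈ X.powerset, s.y S := hmin _ (inr_mem_disjSum.2 hX)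
      linarith
  rcases mem_disjSum.1 hc with ⟨v, hv, rfl⟩ | ⟨X, hX, rfl⟩
  · obtain ⟨S, hS, hvS⟩ := (mem_filter.1 hv).2
    refine ⟨_, Step.buy s _ v hs hε hfeas (fun hvb => ?_) ?_ (Or.inr ⟨S, hS, hvS⟩)⟩
    · obtain ⟨-, x, -, rfl⟩ := h.active_moat S hS
      obtain ⟨hv1, u, hu, hadj⟩ := mem_nbrs.1 hvS
      exact hv1 (mem_comp_of_adj hu hadj hvb)
    · rw [h.load_grow]
      have h1 : (I.w v - I.load s.y v) / k v * k v = I.w v - I.load s.y v :=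
        div_mul_cancel₀ _ (hk v hv).ne'
      change _ + (I.w v - I.load s.y v) / k v * (k v : ℝ) = _
      linarith
  · refine ⟨_, Step.deactivate s _ X hε hfeas hX ?_⟩
    rw [h.sum_powerset_grow _ hX]
    change _ + (I.penalty X - ∑ S ∈ X.powerset, s.y S) = _
    ring

end Growth

end NWPCST

namespace NWPCST

open Finset

/-! ### The approximation guarantee -/

section Analysis

set_option linter.unusedSectionVars false

variable {V : Type*} [Fintype V] [DecidableEq V] {I : NWPCST V}

/-- What the later state `s'` of a run has in common with the earlier state `s`, where `l` lists the
purchases in between. -/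
structure Extends (s s' : State V) (l : List (V × ℕ)) : Prop where
  purchases : s'.purchases = l ++ s.purchases
  later : ∀ p ∈ l, p.1 ∉ s.bought ∧ s.time ≤ p.2
  bought_subset : s.bought ⊆ s'.bought
  bought : ∀ x ∈ s'.bought, x ∉ s.bought → ∃ p ∈ l, p.1 = x
  mark_eq : ∀ u, s.mark u ≠ ⊤ → s'.mark u = s.mark u
  le_mark : ∀ u, s.mark u = ⊤ → (s.time : ℕ∞) ≤ s'.mark u

/-- The induction peels off the first step after `s`; its purchase is the oldest, hence last in `l`.
-/
theorem exists_extends {s s' : State V} (h : Relation.ReflTransGen I.Step s s') :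
    ∃ l, Extends s s' l := by
  induction h using Relation.ReflTransGen.head_induction_on with
  | refl =>
    exact ⟨[], rfl, by simp, subset_rfl, fun x hx hx' => absurd hx hx', fun _ _ => rfl,
      fun u hu => hu ▸ le_top⟩
  | head hstep _ ih =>
    obtain ⟨l, hl⟩ := ih
    cases hstep with
    | buy ε v hactive hε hfeas hv htight hadj =>
      rename_i s₀ _
      refine ⟨l ++ [(v, s₀.time)], by rw [hl.purchases, List.append_assoc]; rfl, ?_,
        (subset_insert _ _).trans hl.bought_subset, ?_, hl.mark_eq, fun u hu => ?_⟩
      · intro p hp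
        rcases List.mem_append.1 hp with hp | hp
        · obtain ⟨h1, h2⟩ := hl.later p hp
          exact ⟨fun h => h1 (mem_insert_of_mem h), (Nat.le_succ _).trans h2⟩
        · rw [List.mem_singleton.1 hp]
          exact ⟨hv, le_rfl⟩
      · intro x hx hx'
        by_cases hxv : x = v
        · exact ⟨(v, s₀.time), by simp, hxv.symm⟩
        · obtain ⟨p, hp, rfl⟩ := hl.bought x hx fun h => (mem_insert.1 h).elim hxv hx'
          exact ⟨p, by simp [hp], rfl⟩
      · exact le_trans (by exact_mod_cast Nat.le_succ _) (hl.le_mark u hu)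
    | deactivate ε X hε hfeas hX htight =>
      rename_i s₀ _
      refine ⟨l, hl.purchases, fun p hp => ?_, hl.bought_subset, hl.bought, fun u hu => ?_,
        fun u hu => ?_⟩
      · obtain ⟨h1, h2⟩ := hl.later p hp
        exact ⟨h1, (Nat.le_succ _).trans h2⟩
      · have h0 : (I.deactivate s₀ ε X).mark u = s₀.mark u := by simp [deactivate, hu]
        rw [← h0]
        exact hl.mark_eq u (h0 ▸ hu)
      · by_cases hc : u ∈ X ∧ I.IsTerminal u
        · have h0 : (I.deactivate s₀ ε X).mark u = s₀.time := by simp [deactivate, hu, hc]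
          rw [hl.mark_eq u (h0 ▸ ENat.natCast_ne_top _), h0]
        · have h0 : (I.deactivate s₀ ε X).mark u = ⊤ := by
            simp only [deactivate]
            rw [if_neg fun h => hc ⟨h.1, h.2.1⟩, hu]
          exact le_trans (by exact_mod_cast Nat.le_succ _) (hl.le_mark u h0)

/-- An active moat that can still grow contains an unmarked terminal. -/
theorem GrowthInv.exists_unmarked {s : State V} (h : I.GrowthInv s) {ε : ℝ} (hε : 0 < ε)
    (hfeas : I.IsDualFeasible (s.grow ε)) {S : Finset V} (hS : S ∈ s.active) :
    ∃ u ∈ S, I.IsTerminal u ∧ s.mark u = ⊤ := by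
  by_contra! hcon
  -- If all terminals of `S` were marked, their tight moats would cover them inside `S`, so `S`
  -- would already be tight.
  have h1 := h.feasible.tight_of_cover (h.active_moat S hS).1 fun u hu hut => by
    obtain ⟨X, huX, hXb, -, hconn, ht, -⟩ := h.marked u (hcon u hu hut)
    refine ⟨X, huX, fun x hx => ?_, ht⟩
    obtain ⟨-, a, -, rfl⟩ := h.active_moat S hS
    exact mem_comp_trans hu (comp_mono hXb _ (hconn x hx))
  have h2 := hfeas.set S (h.mem_dualSets hS)
  rw [h.sum_powerset_grow ε hS] at h2
  linarith

/-- The increase of the dual variables pays for the incidences between the active moats and the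
output. -/
theorem GrowthInv.sum_active_le {s s' : State V} (h : I.GrowthInv s) (h' : I.GrowthInv s')
    (hG : IsPlanar I.G) {l : List (V × ℕ)} (hl : Extends s s' l) {ε : ℝ} (hε : 0 < ε)
    (hfeas : I.IsDualFeasible (s.grow ε)) :
    ∑ S ∈ s.active, #(I.output s' ∩ I.nbrs S) ≤ 3 * #{S ∈ s.active | ¬ Disjoint S (I.output s')} := by
  classical
  set R₀ := I.comp s'.bought I.r with hR₀
  set R := I.prune s'.mark l R₀ with hR
  have hout : I.output s' = I.prune s'.mark s.purchases R := by
    rw [output, hl.purchases, prune_append]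
  have hoR : I.output s' ⊆ R := hout ▸ prune_subset _ _
  have hrR : I.r ∈ R := root_mem_prune
    (fun p hp => h'.purchase_ne_root p (hl.purchases ▸ List.mem_append_left _ hp))
    (mem_comp_self h'.root_mem)
  have hconn : ∀ x ∈ R, x ∈ I.comp R I.r := mem_comp_prune fun x hx => mem_comp_comp hx
  have hclosed : ∀ a ∈ R, ∀ b ∈ s.bought, I.G.Adj a b → b ∈ R :=
    prune_closed (fun p hp => (hl.later p hp).1)
      fun a ha b hb hadj => mem_comp_of_adj ha hadj (hl.bought_subset hb)
  have hsubR : ∀ u ∈ R, I.comp s.bought u ⊆ R := fun u hu => comp_subset_of_closed hu hclosed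
  have hactR : ∀ S ∈ s.active, ∀ u ∈ S, u ∈ R → S ⊆ R := by
    intro S hS u hu huR
    obtain ⟨-, a, -, rfl⟩ := h.active_moat S hS
    rw [← comp_eq_of_mem hu]
    exact hsubR u huR
  have hnb : ∀ S ∈ s.active, ∀ v ∈ I.nbrs S, v ∉ s.bought := by
    intro S hS v hv hvb
    obtain ⟨-, a, -, rfl⟩ := h.active_moat S hS
    obtain ⟨hv1, u, hu, hadj⟩ := mem_nbrs.1 hv
    exact hv1 (mem_comp_of_adj hu hadj hvb)
  have hSb : ∀ S ∈ s.active, S ⊆ s.bought := by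
    intro S hS
    obtain ⟨-, a, -, rfl⟩ := h.active_moat S hS
    exact comp_subset _ _
  -- Only purchases from before `s` remain to be pruned, and none of them may cut off a terminal
  -- unmarked at `s`.
  have hmeet : ∀ S ∈ s.active, S ⊆ R → ¬ Disjoint S (I.output s') := by
    intro S hS hSR
    obtain ⟨u, huS, hut, hum⟩ := h.exists_unmarked hε hfeas hS
    refine not_disjoint_iff.2 ⟨u, huS, ?_⟩
    rw [hout]
    refine mem_prune_of_unmarked hut (fun p hp => ?_) (hSR huS)
    exact lt_of_lt_of_le (by exact_mod_cast h.purchase_lt p hp) (hl.le_mark u hum)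
  -- Neighbours of active moats are unbought at `s`, and a moat adjacent to a vertex of the output
  -- is contained in `R`.
  have hpart : ∑ S ∈ s.active, #(I.output s' ∩ I.nbrs S) ≤
      ∑ S ∈ s.active with S ⊆ R, #((R \ s.bought) ∩ I.nbrs S) := by
    rw [sum_filter]
    refine sum_le_sum fun S hS => ?_
    split_ifs with hSR
    · refine card_le_card fun v hv => ?_
      obtain ⟨h1, h2⟩ := mem_inter.1 hv
      exact mem_inter.2 ⟨mem_sdiff.2 ⟨hoR h1, hnb S hS v h2⟩, h2⟩
    · rw [Nat.le_zero, card_eq_zero]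
      refine eq_empty_of_forall_notMem fun v hv => hSR ?_
      obtain ⟨h1, h2⟩ := mem_inter.1 hv
      obtain ⟨-, u, hu, hadj⟩ := mem_nbrs.1 h2
      exact hactR S hS u hu (hclosed v (hoR h1) u (hSb S hS hu) hadj.symm)
  refine hpart.trans ((sum_card_nbrs_le hconn hG hrR sdiff_subset
    (fun hr => (mem_sdiff.1 hr).2 h.root_mem) (fun S hS => (mem_filter.1 hS).2)
    (fun S hS => ?_) (fun S hS T hT x hxS hxT =>
      h.eq_of_mem_active (mem_filter.1 hS).1 (mem_filter.1 hT).1 hxS hxT)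
    (fun S hS q hq hqS => (mem_sdiff.1 hq).2 (hSb S (mem_filter.1 hS).1 hqS))
    (fun q hq => ?_)).trans ?_)
  · obtain ⟨-, a, ha, rfl⟩ := h.active_moat S (mem_filter.1 hS).1
    exact ⟨a, mem_comp_self ha, fun x hx => mem_comp_comp hx⟩
  · obtain ⟨hqR, hqb⟩ := mem_sdiff.1 hq
    obtain ⟨p, hp, rfl⟩ := hl.bought q (comp_subset _ _ (prune_subset _ _ hqR)) hqb
    obtain ⟨u, huR, hut, hmu, hsep⟩ := exists_separated_of_mem_prune (R := R₀) (mark := s'.mark)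
      ((List.pairwise_append.1 (hl.purchases ▸ h'.sorted)).1) hp hqR
    -- The kept vertex `p.1` separates a terminal `u` that was unmarked when `p.1` was bought, hence
    -- already at `s`. The component of `u` at `s` avoids `p.1`, so it cannot contain the root and
    -- is an active moat.
    have hum : s.mark u = ⊤ := by
      by_contra hne
      have h1 := h.mark_lt u hne
      rw [hl.mark_eq u hne] at hmu
      have h2 : (s.time : ℕ∞) ≤ p.2 := by exact_mod_cast (hl.later p hp).2
      exact absurd (hmu.trans h1) (not_lt.2 h2)
    rcases h.unmarked u hut hum with hr | hact
    · refine absurd (mem_comp_symm ?_) hsep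
      refine comp_mono (fun x hx => mem_erase.2 ⟨?_, hsubR u huR hx⟩) _ (mem_comp_comp hr)
      exact ne_of_mem_of_not_mem (comp_subset _ _ hx) hqb
    · exact ⟨_, mem_filter.2 ⟨hact, hsubR u huR⟩, u, mem_comp_self (h.terminal_mem u hut), hsep⟩
  · refine Nat.mul_le_mul_left 3 (card_le_card fun S hS => ?_)
    obtain ⟨hS, hSR⟩ := mem_filter.1 hS
    exact mem_filter.2 ⟨hS, hmeet S hS hSR⟩

theorem sum_mul_card_output_le {s' : State V} (hs' : I.Reachable s') (hG : IsPlanar I.G) :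
    ∑ S ∈ I.dualSets, s'.y S * #(I.output s' ∩ I.nbrs S) ≤
      3 * ∑ S ∈ I.dualSets with ¬ Disjoint S (I.output s'), s'.y S := by
  classical
  -- The coefficients depend only on the final output, so `∑ y_S g S` is linear in `y` and can be
  -- bounded growth by growth along the run.
  let g : Finset V → ℝ := fun S =>
    #(I.output s' ∩ I.nbrs S) - 3 * if ¬ Disjoint S (I.output s') then 1 else 0
  have key : ∀ s, I.Reachable s → Relation.ReflTransGen I.Step s s' →
      ∑ S ∈ I.dualSets, s.y S * g S ≤ 0 := by
    intro s hs
    induction hs with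
    | refl => exact fun _ => by simp [init]
    | tail hs hstep ih =>
      rename_i s s₁
      intro hs₁
      have hrun : Relation.ReflTransGen I.Step s s' := Relation.ReflTransGen.head hstep hs₁
      obtain ⟨ε, hε, hfeas, hy⟩ := hstep.exists_grow
      have hinv := Reachable.growthInv hs
      have hact : {S ∈ s.active | S ∈ I.dualSets} = s.active :=
        filter_true_of_mem fun S hS => hinv.mem_dualSets hS
      rw [hy, State.sum_grow_mul, hact]
      have h1 := ih hrun
      rcases hε.eq_or_lt with rfl | hε
      · linarith
      obtain ⟨l, hl⟩ := exists_extends hrun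
      have h2 := hinv.sum_active_le hs'.growthInv hG hl hε hfeas
      have h3 : ∑ S ∈ s.active, g S ≤ 0 := by
        simp only [g, sum_sub_distrib, ← mul_sum, sum_boole]
        have h2' : (∑ S ∈ s.active, (#(I.output s' ∩ I.nbrs S) : ℝ)) ≤
          3 * #{S ∈ s.active | ¬ Disjoint S (I.output s')} := by exact_mod_cast h2
        linarith
      have h4 := mul_nonpos_of_nonneg_of_nonpos hε.le h3
      linarith
  have h := key s' hs' .refl
  simp only [g, mul_sub, sum_sub_distrib] at h
  rw [sum_filter, mul_sum]
  refine (sub_nonpos.1 h).trans (le_of_eq (sum_congr rfl fun S _ => ?_))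
  split_ifs <;> ring

theorem GrowthInv.root_mem_output {s : State V} (h : I.GrowthInv s) : I.r ∈ I.output s :=
  root_mem_prune h.purchase_ne_root (mem_comp_self h.root_mem)

theorem GrowthInv.isSolution_output {s : State V} (h : I.GrowthInv s) :
    I.IsSolution (I.output s) :=
  isSolution_of_forall_mem_comp h.root_mem_output (mem_comp_prune fun _ hx => mem_comp_comp hx)

theorem GrowthInv.weight_output_le {s : State V} (h : I.GrowthInv s) :
    I.weight (I.output s) ≤ ∑ S ∈ I.dualSets, s.y S * #(I.output s ∩ I.nbrs S) := by
  rw [← sum_load_eq]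
  exact sum_le_sum fun v hv => h.tight v (comp_subset _ _ (prune_subset _ _ hv))

/-- The penalties of the complement of the output are paid for by the dual variables of its
subsets. -/
theorem GrowthInv.penalty_output_le {s : State V} (h : I.GrowthInv s) (hs : s.active = ∅) :
    I.penalty (I.output s)ᶜ ≤ ∑ S ∈ (I.output s)ᶜ.powerset, s.y S := by
  refine h.feasible.tight_of_cover (fun hr => mem_compl.1 hr h.root_mem_output) fun u hu hut => ?_
  have hu' := mem_compl.1 hu
  -- Without active moats, an unmarked terminal lies in the root component, and no deletion may cut
  -- it off.
  have hmark : s.mark u ≠ ⊤ := by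
    intro hm
    rcases h.unmarked u hut hm with hr | hact
    · refine hu' (mem_prune_of_unmarked hut (fun p _ => ?_) (mem_comp_symm hr))
      rw [hm]
      exact ENat.natCast_lt_top _
    · simp [hs] at hact
  obtain ⟨X, huX, hXb, -, hconn, ht, hp⟩ := h.marked u hmark
  refine ⟨X, huX, fun x hx => mem_compl.2 ?_, ht⟩
  refine disjoint_prune h.sorted hut hconn (fun p => hp p) (fun z hz hzR y hy => ?_) huX hu' x hx
  refine mem_comp_trans hzR (comp_mono hXb _ ?_)
  exact mem_comp_trans (mem_comp_symm (hconn z hz)) (hconn y hy)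

theorem approximation {s : State V} (hs : I.Reachable s) (hact : s.active = ∅)
    (hG : IsPlanar I.G) :
    I.weight (I.output s) + 3 * I.penalty (I.output s)ᶜ ≤ 3 * ∑ S ∈ I.dualSets, s.y S := by
  have h := hs.growthInv
  have h1 := h.weight_output_le
  have h2 := sum_mul_card_output_le hs hG
  have h3 := h.penalty_output_le hact
  rw [← filter_disjoint_dualSets h.root_mem_output] at h3
  have h4 := sum_filter_add_sum_filter_not I.dualSets (fun S => Disjoint S (I.output s)) s.y
  linarith

end Analysis

end NWPCST

/-- On a planar graph the growth phase never gets stuck and always terminates, and whenever it ends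
(however ties are broken), the dual `y` is feasible, and the output `F'` is a solution with
`w(F') + 3 Π(V ∖ F') ≤ 3 ∑ y_S ≤ 3 OPT`. -/
theorem theorem1 {V : Type*} [Fintype V] [DecidableEq V] (I : NWPCST V) (hG : IsPlanar I.G) :
    (∀ s, I.Reachable s → s.active.Nonempty → ∃ s', I.Step s s') ∧
    (¬ ∃ run : ℕ → NWPCST.State V, run 0 = I.init ∧ ∀ n, I.Step (run n) (run (n + 1))) ∧
    (∀ s, I.Reachable s → s.active = ∅ →
      I.IsDualFeasible s.y ∧
      I.IsSolution (I.output s) ∧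
      I.weight (I.output s) + 3 * I.penalty (I.output s)ᶜ ≤ 3 * ∑ S ∈ I.dualSets, s.y S ∧
      3 * ∑ S ∈ I.dualSets, s.y S ≤ 3 * I.opt) := by
  refine ⟨fun s hs hne => hs.growthInv.exists_step hne, I.not_exists_infinite_run,
    fun s hs hact => ?_⟩
  have h := hs.growthInv
  exact ⟨h.feasible, h.isSolution_output, NWPCST.approximation hs hact hG,
    mul_le_mul_of_nonneg_left h.feasible.sum_le_opt (by norm_num)⟩
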